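/- Let $E=(0,1]$ and let $M_p(E)$ be the space of $\mathbb Z_+$-valued Radon measures on $E$ (finite on relatively compact Borel sets), with the vague topology and its Borel $\sigma$-algebra $\mathcal M_p(E)$; a point process on $E$ is a random element of $M_p(E)$. Write $\mu(f)=\int f\,d\mu$. For $\mu\in M_p(E)$ let $x_\mu$ be the largest point of $\mu$ (and $x_\mu=0$ if $\mu=0$), and for $x>0$ let $M_x=\{\mu\neq 0:\ \mu((x,\infty)\cap E)>0\}$. Let $(\xi_j)_{j\ge1}$ be a strictly stationary sequence of real random variables on a probability space $(\Omega,\mathcal K,P)$ and $(u_n)$ real numbers with $nP(\xi_1>u_n)\to1$. Let $$N_n=\sum_{j=1}^n 1_{\{\xi_j>u_n\}}\delta_{j/n}$$ and, for integers $k_n$, put $r_n=\lfloor n/k_n\rfloor$, $J_{i,n}=((i-1)r_n,ir_n]\cap\mathbb Z$, $N_{i,n}=\sum_{j\in J_{i,n}}1_{\{\xi_j>u_n\}}\delta_{j/n}$ and $Y_{i,n}=x_{N_{i,n}}$ for $1\le i\le k_n$. Suppose that $(N_n)$ satisfies condition (AI) with the array $(N_{i,n})_{i\le k_n}$, that is,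 $k_n\to\infty$, $$\lim_{n\to\infty}\max_{i\le k_n}P(N_{i,n}(B)>0)=0\quad\text{for every relatively compact Borel set } B\subset E,$$ $$\lim_{n\to\infty}\Big|E\big(e^{-N_n(f)}\big)-\prod_{i=1}^{k_n}E\big(e^{-N_{i,n}(f)}\big)\Big|=0\quad\text{for every continuous } f:E\to[0,\infty)\text{ with compact support}.$$ Suppose also that $$k_nP\Big(\max_{j\in J_{1,n}}\xi_j>u_n\Big)\to a\ \text{ for some } a>0,$$ $$\pi_n(k):=P\Big(\sum_{j\in J_{1,n}}1_{\{\xi_j>u_n\}}=k\,\Big|\,\max_{j\in J_{1,n}}\xi_j>u_n\Big)\to\pi_k\quad\text{for all } k\ge1.$$ Then there is an infinitely divisible point process $N$ on $E$ with canonical measure $\lambda$, that is, $\lambda$ is a measure on $M_p(E)$ with $\lambda(\{0\})=0$, with $\int(1-e^{-\mu(B)})\,\lambda(d\mu)<\infty$ for all relatively compact Borel sets $B$, and with $E(e^{-N(f)})=\exp\{-\int(1-e^{-\mu(f)})\,\lambda(d\mu)\}$ for all measurable $f:E\to[0,\infty)$, such that the following holds. Let $D'=\{x>0:\ P(N\{x\}>0)>0\}$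 be the set of fixed atoms of $N$. (a) $\sum_{i=1}^{k_n}P(Y_{i,n}>x)\to\lambda(M_x)$ for all $x>0$, $x\notin D'$. (b) $\sum_{i=1}^{k_n}P(Y_{i,n}>x,\ N_{i,n}\in M)\to\lambda(M\cap M_x)$ for all $x>0$, $x\notin D'$, with $\lambda(M_x)>0$, and for every $M\in\mathcal M_p(E)$ with $0\notin M$ and $\lambda(\partial M\cap M_x)=0$. Moreover, for all $x>0$ and all $M\in\mathcal M_p(E)$, $$\lambda(M_x)=\nu(x,\infty)\quad\text{and}\quad\lambda(M\cap M_x)=\int_x^\infty K(y,M)\,\nu(dy),$$ where $$\nu(dy)=a\,1_{(0,1]}(y)\,dy\quad\text{and}\quad K(y,M)=\sum_{k\ge1}\pi_k1_M(k\delta_y),$$ and $K$ is a transition kernel: each $K(y,\cdot)$ is a probability measure on $M_p(E)$, and $K(\cdot,M)$ is Borel measurable for each $M$. (Since $\nu$ is carried by $(0,1]$, the values of $K(y,\cdot)$ for $y>1$ do not matter; there $\delta_y$ is read as $\delta_1$.) -/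

import Mathlib

open MeasureTheory ProbabilityTheory Filter Topology
open scoped ENNReal NNReal CompactlySupported

noncomputable section

namespace ExceedanceProcess

section General

variable (E : Type*) [TopologicalSpace E] [MeasurableSpace E]

/-- The additive monoid of the `ℤ₊`-valued Radon measures on `E`: every relatively compact Borel
set has a (finite) integer mass. -/
def pointMeasures : AddSubmonoid (Measure E) where
  carrier := {μ | ∀ B : Set E, MeasurableSet B → IsCompact (closure B) → ∃ m : ℕ, μ B = m}
  zero_mem' := fun _ _ _ => ⟨0, by simp⟩
  add_mem' := by
    intro μ ν hμ hν B hB hc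
    obtain ⟨m, hm⟩ := hμ B hB hc
    obtain ⟨l, hl⟩ := hν B hB hc
    exact ⟨m + l, by simp [hm, hl]⟩

/-- The space `M_p(E)`. It is a type of its own, so that it does not inherit a σ-algebra from
`Measure E`: its σ-algebra is the Borel one of the vague topology, below. -/
def PointMeasure : Type _ := ↥(pointMeasures E)

instance : AddCommMonoid (PointMeasure E) := inferInstanceAs (AddCommMonoid ↥(pointMeasures E))

variable {E}

/-- The measure underlying an element of `M_p(E)`. -/
def PointMeasure.toMeasure (μ : PointMeasure E) : Measure E := Subtype.val μ

/-- The unit mass `δ_y`. -/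
def PointMeasure.dirac (y : E) : PointMeasure E :=
  ⟨Measure.dirac y, fun B hB _ => by
    by_cases h : y ∈ B
    · exact ⟨1, by simp [Measure.dirac_apply' y hB, h]⟩
    · exact ⟨0, by simp [Measure.dirac_apply' y hB, h]⟩⟩

/-- The vague topology: the coarsest one for which `μ ↦ μ(f)` is continuous for all
`f ∈ C_K⁺(E)`. -/
instance : TopologicalSpace (PointMeasure E) :=
  ⨅ f : C_c(E, ℝ≥0),
    TopologicalSpace.induced (fun μ : PointMeasure E => ∫⁻ y, (f y : ℝ≥0∞) ∂μ.toMeasure)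
      inferInstance

/-- The Borel σ-algebra of the vague topology. -/
instance : MeasurableSpace (PointMeasure E) := borel _

instance : BorelSpace (PointMeasure E) := ⟨rfl⟩

/-- `e^{-t}` for `t ∈ [0, ∞]`, with `e^{-∞} = 0`. -/
def expNeg (t : ℝ≥0∞) : ℝ≥0∞ := EReal.exp (-(t : EReal))

variable {Ω : Type*} [MeasurableSpace Ω]

/-- The Laplace functional `L_N(f) = E(e^{-N(f)})`. -/
def laplace (P : Measure Ω) (N : Ω → PointMeasure E) (f : E → ℝ≥0) : ℝ≥0∞ :=
  ∫⁻ ω, expNeg (∫⁻ y, (f y : ℝ≥0∞) ∂(N ω).toMeasure) ∂P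

/-- The sequence `N n` of point processes satisfies the asymptotic independence condition (AI)
with the array `Ni n i`, `1 ≤ i ≤ k n`. -/
structure AsymptoticallyIndependent (P : Measure Ω) (N : ℕ → Ω → PointMeasure E)
    (k : ℕ → ℕ) (Ni : ℕ → ℕ → Ω → PointMeasure E) : Prop where
  measurable : ∀ n, 1 ≤ n → Measurable (N n)
  measurable_component : ∀ n, 1 ≤ n → ∀ i ∈ Finset.Icc 1 (k n), Measurable (Ni n i)
  tendsto_card : Tendsto k atTop atTop
  null_array : ∀ B : Set E, MeasurableSet B → IsCompact (closure B) →
    Tendsto (fun n => ⨆ i ∈ Finset.Icc 1 (k n), P {ω | 0 < (Ni n i ω).toMeasure B})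
      atTop (𝓝 0)
  laplace_sub_prod : ∀ f : C_c(E, ℝ≥0),
    Tendsto (fun n => |(laplace P (N n) f).toReal -
      ∏ i ∈ Finset.Icc 1 (k n), (laplace P (Ni n i) f).toReal|) atTop (𝓝 0)

/-- The point process `N` is infinitely divisible: for every `m ≥ 1` it is equal in distribution to
the sum of `m` i.i.d. point processes (`IdentDistrib` is equality in distribution). -/
def InfinitelyDivisible (P : Measure Ω) (N : Ω → PointMeasure E) : Prop :=
  ∀ m : ℕ, 1 ≤ m → ∃ (Ω' : Type) (_ : MeasurableSpace Ω') (P' : Measure Ω')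
    (_ : IsProbabilityMeasure P') (N' : Fin m → Ω' → PointMeasure E),
    (∀ i, Measurable (N' i)) ∧ iIndepFun N' P' ∧
    (∀ i j, IdentDistrib (N' i) (N' j) P' P') ∧
    IdentDistrib N (fun ω => ∑ i, N' i ω) P P'

/-- `Λ` is the canonical measure of the (infinitely divisible) point process `N`. -/
structure IsCanonicalMeasure (P : Measure Ω) (N : Ω → PointMeasure E)
    (Λ : Measure (PointMeasure E)) : Prop where
  null : Λ {0} = 0
  lintegral_lt_top : ∀ B : Set E, MeasurableSet B → IsCompact (closure B) →
    ∫⁻ μ, (1 - expNeg (μ.toMeasure B)) ∂Λ < ∞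
  laplace_eq : ∀ f : E → ℝ≥0, Measurable f →
    laplace P N f = expNeg (∫⁻ μ, (1 - expNeg (∫⁻ y, (f y : ℝ≥0∞) ∂μ.toMeasure)) ∂Λ)

end General

/-- The state space `(0, 1]`. -/
abbrev E : Type := ↥(Set.Ioc (0 : ℝ) 1)

/-- `x_μ`, the largest point of `μ` in modulus; it is `0` for the null measure. -/
def maxPoint (μ : PointMeasure E) : ℝ :=
  sSup {t : ℝ | ∃ y : E, 0 < μ.toMeasure {y} ∧ t = |(y : ℝ)|}

/-- `M_x`, the set of the nonnull `μ` with a point in `[-x, x]ᶜ`. -/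
def exceedSet (x : ℝ) : Set (PointMeasure E) :=
  {μ | μ ≠ 0 ∧ 0 < μ.toMeasure {y : E | x < |(y : ℝ)|}}

variable {Ω : Type*} [MeasurableSpace Ω]

/-- The set `D` of the fixed atoms of a point process `N`. -/
def fixedAtoms (P : Measure Ω) (N : Ω → PointMeasure E) : Set E :=
  {y | 0 < P {ω | 0 < (N ω).toMeasure {y}}}

/-- The set `D'` of all `x > 0` such that `x` or `-x` is a fixed atom of `N`. -/
def fixedModuli (P : Measure Ω) (N : Ω → PointMeasure E) : Set ℝ :=
  {x | 0 < x ∧ ∃ y ∈ fixedAtoms P N, (y : ℝ) = x ∨ (y : ℝ) = -x}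

/-- Condition (a): `∑_i P(Y_{i,n} > x) → Λ(M_x)` for all `x > 0` outside `D'`, where `Y_{i,n}` is
the largest point of `Ni n i`. -/
def ConditionA (P : Measure Ω) (k : ℕ → ℕ) (Ni : ℕ → ℕ → Ω → PointMeasure E)
    (D' : Set ℝ) (Λ : Measure (PointMeasure E)) : Prop :=
  ∀ x : ℝ, 0 < x → x ∉ D' →
    Tendsto (fun n => ∑ i ∈ Finset.Icc 1 (k n), P {ω | x < maxPoint (Ni n i ω)})
      atTop (𝓝 (Λ (exceedSet x)))

/-- Condition (b): `∑_i P(Y_{i,n} > x, N_{i,n} ∈ M) → Λ(M ∩ M_x)` for all `x > 0` outside `D'` with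
`Λ(M_x) > 0` and all Borel sets `M` of nonnull measures with `Λ(∂M ∩ M_x) = 0`. -/
def ConditionB (P : Measure Ω) (k : ℕ → ℕ) (Ni : ℕ → ℕ → Ω → PointMeasure E)
    (D' : Set ℝ) (Λ : Measure (PointMeasure E)) : Prop :=
  ∀ x : ℝ, 0 < x → x ∉ D' → 0 < Λ (exceedSet x) →
    ∀ M : Set (PointMeasure E), MeasurableSet M → 0 ∉ M → Λ (frontier M ∩ exceedSet x) = 0 →
      Tendsto (fun n => ∑ i ∈ Finset.Icc 1 (k n), P {ω | x < maxPoint (Ni n i ω) ∧ Ni n i ω ∈ M})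
        atTop (𝓝 (Λ (M ∩ exceedSet x)))

/-- The real number `t`, seen as a point of `(0, 1]`; the value outside `(0, 1]` plays no role. -/
def toE (t : ℝ) : E :=
  open Classical in if h : t ∈ Set.Ioc (0 : ℝ) 1 then ⟨t, h⟩ else ⟨1, by norm_num⟩

/-- `(ξ j)_{j ≥ 1}` is strictly stationary. -/
def StationarySeq (P : Measure Ω) (ξ : ℕ → Ω → ℝ) : Prop :=
  ∀ h : ℕ, IdentDistrib (fun ω (j : ℕ) => ξ (j + 1) ω) (fun ω (j : ℕ) => ξ (j + 1 + h) ω) P P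

/-- The block `J_{i,n} = ((i-1) r_n, i r_n]` of indices (for `i ≥ 1`), where `r_n = ⌊n / k_n⌋`. -/
def block (k : ℕ → ℕ) (n i : ℕ) : Finset ℕ :=
  Finset.Ioc ((i - 1) * (n / k n)) (i * (n / k n))

/-- The point process `∑_{j ∈ J} δ_{j/n} 1_{ξ_j > u_n}`, for a set `J` of indices. -/
def exceedOn (ξ : ℕ → Ω → ℝ) (u : ℕ → ℝ) (n : ℕ) (J : Finset ℕ) (ω : Ω) : PointMeasure E :=
  ∑ j ∈ J, if u n < ξ j ω then PointMeasure.dirac (toE ((j : ℝ) / n)) else 0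

/-- The exceedance process `N_n`. -/
def exceedProcess (ξ : ℕ → Ω → ℝ) (u : ℕ → ℝ) (n : ℕ) : Ω → PointMeasure E :=
  exceedOn ξ u n (Finset.Icc 1 n)

/-- The block component `N_{i,n}` of the exceedance process. -/
def blockProcess (ξ : ℕ → Ω → ℝ) (u : ℕ → ℝ) (k : ℕ → ℕ) (n i : ℕ) : Ω → PointMeasure E :=
  exceedOn ξ u n (block k n i)

/-- The event `max_{j ∈ J_{1,n}} ξ_j > u_n` (the maximum over an empty block is `-∞`). -/
def blockExceeds (ξ : ℕ → Ω → ℝ) (u : ℕ → ℝ) (k : ℕ → ℕ) (n : ℕ) : Set Ω :=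
  {ω | (u n : EReal) < (block k n 1).sup fun j => (ξ j ω : EReal)}

/-- The cluster size distribution `π_n(m)`: the conditional probability that there are exactly `m`
exceedances in the first block, given that there is at least one. -/
def clusterProb (P : Measure Ω) (ξ : ℕ → Ω → ℝ) (u : ℕ → ℝ) (k : ℕ → ℕ) (n m : ℕ) : ℝ :=
  (P[|blockExceeds ξ u k n]).real {ω | ∑ j ∈ block k n 1, (if u n < ξ j ω then 1 else 0) = m}

/-- The measure `ν(dy) = a 1_{(0,1]}(y) dy`. -/
def clusterIntensity (a : ℝ) : Measure ℝ :=
  ENNReal.ofReal a • (volume : Measure ℝ).restrict (Set.Ioc 0 1)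

/-- The kernel `K(y, ·) = ∑_{m ≥ 1} π_m δ_{m δ_y}`. Only `y ∈ (0, 1]` matters, because
`clusterIntensity a` lives there; for `y > 1`, `toE` puts `1` in place of `y`. -/
def clusterKernel (p : ℕ → ℝ) (y : ℝ) : Measure (PointMeasure E) :=
  Measure.sum fun m : ℕ =>
    ENNReal.ofReal (p (m + 1)) • Measure.dirac ((m + 1) • PointMeasure.dirac (toE y))

/-- `K` is a transition kernel from `(0, ∞)` to `M_p(E)`. -/
def IsTransitionKernel (K : ℝ → Measure (PointMeasure E)) : Prop :=
  (∀ y : ℝ, 0 < y → IsProbabilityMeasure (K y)) ∧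
  ∀ M : Set (PointMeasure E), MeasurableSet M →
    Measurable fun y : ↥(Set.Ioi (0 : ℝ)) => K y M

/-- `Λ(M_x) = ν(x, ∞)` and `Λ(M ∩ M_x) = ∫_x^∞ K(y, M) ν(dy)` for all `x > 0` and all Borel
sets `M`. -/
def DisintegratesAs (Λ : Measure (PointMeasure E)) (ν : Measure ℝ)
    (K : ℝ → Measure (PointMeasure E)) : Prop :=
  ∀ M : Set (PointMeasure E), MeasurableSet M → ∀ x : ℝ, 0 < x →
    Λ (exceedSet x) = ν (Set.Ioi x) ∧ Λ (M ∩ exceedSet x) = ∫⁻ y in Set.Ioi x, K y M ∂ν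

end ExceedanceProcess

end

/-! The limit is a compound Poisson process: a Poisson number, of mean `a`, of independent clusters
`m δ_y`, with `y` uniform on `(0, 1]` and `m` distributed according to `p`. Its canonical measure is
`a` times the law of one cluster, so infinite divisibility, the Laplace functional and the
disintegration come from the construction. What remains is that `p` sums to one and that the sums
over blocks converge.

No mass of `p` escapes to infinity (`hasSum_cluster`): the blocks together have at most `n P(ξ_1 >
u_n) → 1` expected exceedances, so by Markov's inequality `k_n P(more than L exceedances in a
block)` is at most `n P(ξ_1 > u_n) / (L + 1)`.

The blocks omit the indices in `(k_n r_n, n]`, and `k_n → ∞` alone does not make these negligible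
(`tendsto_blockCover`). If they formed a fraction `c` of all indices for infinitely many `n`, then
(AI), tested on a function vanishing on every block, would make exceedances in a final window
improbable. By stationarity they would be improbable in all of `[1, n]`, and by (AI) again every
product of block Laplace functionals would tend to `1`. But about half of the blocks stay away from
`0`, and each of them has an exceedance with probability about `a / k_n`, which keeps a suitable
product away from `1`.

Hence the block number `⌈k_n y⌉`, rescaled by `1/n`, shrinks to `y`. A sum of `c_i` over the blocks
is the integral of `k_n c_{⌈k_n y⌉}` over `(0, 1]`. Dominated convergence gives (a). For open `M`,
points close to `y` form a measure vaguely close to a multiple of `δ_y`, and Fatou's lemma gives the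
lower bound in (b). Applied to `M` and to its complement, whose sums add up to the convergent ones
of (a), the lower bounds become limits. -/

noncomputable section

namespace ExceedanceProcess

/-! ### Point measures and the vague topology -/

section General

variable {E : Type*} [TopologicalSpace E] [MeasurableSpace E]

/-- The inclusion of `M_p(E)` in the measures on `E`, as an additive homomorphism. -/
def PointMeasure.toMeasureHom : PointMeasure E →+ Measure E := (pointMeasures E).subtype

@[simp] theorem PointMeasure.toMeasure_zero : (0 : PointMeasure E).toMeasure = 0 := rfl

@[simp] theorem PointMeasure.toMeasure_add (μ ν : PointMeasure E) :
    (μ + ν).toMeasure = μ.toMeasure + ν.toMeasure := rfl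

@[simp] theorem PointMeasure.toMeasure_nsmul (m : ℕ) (μ : PointMeasure E) :
    (m • μ).toMeasure = m • μ.toMeasure := map_nsmul PointMeasure.toMeasureHom m μ

@[simp] theorem PointMeasure.toMeasure_sum {ι : Type*} (s : Finset ι) (μ : ι → PointMeasure E) :
    (∑ i ∈ s, μ i).toMeasure = ∑ i ∈ s, (μ i).toMeasure :=
  map_sum PointMeasure.toMeasureHom μ s

@[simp] theorem PointMeasure.toMeasure_dirac (y : E) :
    (PointMeasure.dirac y).toMeasure = Measure.dirac y := rfl

theorem PointMeasure.toMeasure_injective :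
    Function.Injective (PointMeasure.toMeasure : PointMeasure E → Measure E) :=
  Subtype.val_injective

theorem PointMeasure.measure_lt_top (μ : PointMeasure E) {B : Set E} (hB : MeasurableSet B)
    (hc : IsCompact (closure B)) : μ.toMeasure B < ∞ := by
  obtain ⟨m, hm⟩ := Subtype.prop μ B hB hc
  change (Subtype.val μ) B < ∞
  rw [hm]
  exact ENNReal.natCast_lt_top m

theorem continuous_lintegral_pointMeasure (f : C_c(E, ℝ≥0)) :
    Continuous fun μ : PointMeasure E => ∫⁻ y, (f y : ℝ≥0∞) ∂μ.toMeasure :=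
  continuous_iInf_dom (i := f) continuous_induced_dom

theorem continuous_pointMeasure_iff {X : Type*} [TopologicalSpace X] {g : X → PointMeasure E} :
    Continuous g ↔
      ∀ f : C_c(E, ℝ≥0), Continuous fun x => ∫⁻ y, (f y : ℝ≥0∞) ∂(g x).toMeasure := by
  rw [continuous_iInf_rng]
  simp_rw [continuous_induced_rng]
  rfl

instance : ContinuousAdd (PointMeasure E) where
  continuous_add := by
    rw [continuous_pointMeasure_iff]
    intro f
    simp only [PointMeasure.toMeasure_add, lintegral_add_measure]
    exact ((continuous_lintegral_pointMeasure f).comp continuous_fst).add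
      ((continuous_lintegral_pointMeasure f).comp continuous_snd)

theorem continuous_dirac_pointMeasure [OpensMeasurableSpace E] :
    Continuous (PointMeasure.dirac : E → PointMeasure E) := by
  rw [continuous_pointMeasure_iff]
  intro f
  have hm : Measurable fun y => (f y : ℝ≥0∞) :=
    (ENNReal.continuous_coe.comp f.continuous).measurable
  simp only [PointMeasure.toMeasure_dirac, lintegral_dirac' _ hm]
  exact ENNReal.continuous_coe.comp f.continuous

theorem lintegral_compactlySupported_lt_top [OpensMeasurableSpace E] (μ : PointMeasure E)
    (f : C_c(E, ℝ≥0)) : ∫⁻ y, (f y : ℝ≥0∞) ∂μ.toMeasure < ∞ := by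
  have hK : IsCompact (tsupport f) := f.hasCompactSupport
  obtain ⟨C, hC⟩ := hK.bddAbove_image f.continuous.continuousOn
  have hle : ∀ y, (f y : ℝ≥0∞) ≤ (tsupport f).indicator (fun _ => (C : ℝ≥0∞)) y := by
    intro y
    by_cases hy : y ∈ tsupport f
    · simp only [hy, Set.indicator_of_mem]
      exact_mod_cast hC (Set.mem_image_of_mem _ hy)
    · simp [image_eq_zero_of_notMem_tsupport hy]
  calc ∫⁻ y, (f y : ℝ≥0∞) ∂μ.toMeasure
      ≤ ∫⁻ y, (tsupport f).indicator (fun _ => (C : ℝ≥0∞)) y ∂μ.toMeasure := lintegral_mono hle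
    _ = C * μ.toMeasure (tsupport f) := by
        rw [lintegral_indicator_const (isClosed_tsupport f).measurableSet]
    _ < ∞ := ENNReal.mul_lt_top ENNReal.coe_lt_top (μ.measure_lt_top
        (isClosed_tsupport f).measurableSet (by rwa [(isClosed_tsupport f).closure_eq]))

end General

/-! ### Second countability of the vague topology -/

/-- A continuous `γ` is locally bounded, so an error of `ε * γ` is locally uniformly small. -/
theorem continuous_of_forall_approx {X : Type*} [TopologicalSpace X] {φ γ : X → ℝ}
    (hγ : Continuous γ)
    (h : ∀ ε > 0, ∃ ψ : X → ℝ, Continuous ψ ∧ ∀ x, |φ x - ψ x| ≤ ε * γ x) : Continuous φ := by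
  apply continuous_of_locally_uniform_approx_of_continuousAt
  intro x v hv
  obtain ⟨ε, hε, hεv⟩ := Metric.mem_uniformity_dist.1 hv
  have hpos : 0 < |γ x| + 1 := by positivity
  obtain ⟨ψ, hψ, hφψ⟩ := h (ε / (|γ x| + 1)) (by positivity)
  refine ⟨{y | γ y < |γ x| + 1}, ?_, ψ, hψ.continuousAt, fun y hy => hεv ?_⟩
  · exact (isOpen_lt hγ continuous_const).mem_nhds (by
      have := le_abs_self (γ x)
      simp only [Set.mem_ofPred_eq]; linarith)
  · rw [Real.dist_eq]
    calc |φ y - ψ y| ≤ ε / (|γ x| + 1) * γ y := hφψ y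
      _ < ε / (|γ x| + 1) * (|γ x| + 1) := by
          apply mul_lt_mul_of_pos_left hy; positivity
      _ = ε := by field_simp

theorem isCompact_setOf_le {x : ℝ} (hx : 0 < x) : IsCompact {y : E | x ≤ y} := by
  rw [Topology.IsInducing.subtypeVal.isCompact_iff]
  have : (Subtype.val '' {y : E | x ≤ y}) = Set.Icc x 1 := by
    ext t
    constructor
    · rintro ⟨y, hy, rfl⟩
      exact ⟨hy, y.2.2⟩
    · rintro ⟨h1, h2⟩
      exact ⟨⟨t, hx.trans_le h1, h2⟩, h1, rfl⟩
  rw [this]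
  exact isCompact_Icc

/-- The test function `y ↦ c (y - x)⁺` on `(0, 1]`, for `x > 0`. -/
def ramp (c : ℝ≥0) {x : ℝ} (hx : 0 < x) : C_c(E, ℝ≥0) where
  toFun y := c * Real.toNNReal (y - x)
  continuous_toFun := by fun_prop
  hasCompactSupport' := HasCompactSupport.intro (isCompact_setOf_le hx) fun y hy => by
    simp only [Set.mem_ofPred_eq, not_le] at hy
    simp [Real.toNNReal_of_nonpos (sub_nonpos.2 hy.le)]

theorem ramp_apply (c : ℝ≥0) {x : ℝ} (hx : 0 < x) (y : E) :
    ramp c hx y = c * Real.toNNReal (y - x) := rfl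

/-- Restriction to the compact set `[x, 1]` loses nothing on functions vanishing below `x`, and the
continuous functions there form a separable space. -/
theorem exists_countable_dense_supported {x : ℝ} (hx : 0 < x) :
    ∃ D : Set C_c(E, ℝ≥0), D.Countable ∧ (∀ h ∈ D, ∀ y : E, (y : ℝ) < x → h y = 0) ∧
      ∀ f : C_c(E, ℝ≥0), (∀ y : E, (y : ℝ) < x → f y = 0) → ∀ ε > 0, ∃ h ∈ D,
        ∀ y, |(f y : ℝ) - h y| < ε := by
  let K : Set E := {y : E | x ≤ y}
  have : CompactSpace K := isCompact_iff_compactSpace.1 (isCompact_setOf_le hx)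
  let R : C_c(E, ℝ≥0) → C(K, ℝ≥0) := fun f => f.toContinuousMap.restrict K
  let A : Set C_c(E, ℝ≥0) := {f | ∀ y : E, (y : ℝ) < x → f y = 0}
  obtain ⟨t, htA, htc, hAt⟩ :=
    (TopologicalSpace.IsSeparable.of_separableSpace (R '' A)).exists_countable_dense_subset
  have hex : ∀ s ∈ t, ∃ f, f ∈ A ∧ R f = s := fun s hs => htA hs
  choose! g hgA hg using hex
  refine ⟨g '' t, htc.image g, ?_, ?_⟩
  · rintro _ ⟨s, hs, rfl⟩
    exact hgA s hs
  · intro f hf ε hε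
    obtain ⟨s, hs, hfs⟩ := Metric.mem_closure_iff.1 (hAt ⟨f, hf, rfl⟩) ε hε
    refine ⟨g s, ⟨s, hs, rfl⟩, fun y => ?_⟩
    by_cases hy : x ≤ (y : ℝ)
    · rw [← hg s hs] at hfs
      have := (ContinuousMap.dist_apply_le_dist (f := R f) (g := R (g s)) ⟨y, hy⟩).trans_lt hfs
      exact this
    · rw [hf y (not_le.1 hy), hgA s hs y (not_le.1 hy)]
      simpa using hε

theorem exists_supported (f : C_c(E, ℝ≥0)) :
    ∃ j : ℕ, ∀ y : E, (y : ℝ) < 1 / ((j : ℝ) + 1) → f y = 0 := by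
  have hK : IsCompact (tsupport f) := f.hasCompactSupport
  rcases (tsupport f).eq_empty_or_nonempty with h0 | hne
  · exact ⟨0, fun y _ => image_eq_zero_of_notMem_tsupport (by simp [h0])⟩
  · obtain ⟨z, -, hz⟩ := hK.exists_isMinOn hne continuous_subtype_val.continuousOn
    obtain ⟨j, hj⟩ := exists_nat_one_div_lt z.2.1
    refine ⟨j, fun y hy => image_eq_zero_of_notMem_tsupport fun hys => ?_⟩
    have := hz hys
    simp only [Set.mem_ofPred_eq] at this
    linarith

/-- The ramp of slope `2 / x` starting at `x / 2` is at least `1` on `[x, 1]`, so it dominates `|f -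
h| / ε`. The total mass of `μ` may be infinite, hence the bound by the integral of a test function.
-/
theorem abs_toReal_lintegral_sub_le {x : ℝ} (hx : 0 < x) (μ : PointMeasure E)
    {f h : C_c(E, ℝ≥0)} {ε : ℝ} (hε : 0 < ε)
    (hf : ∀ y : E, (y : ℝ) < x → f y = 0) (hh : ∀ y : E, (y : ℝ) < x → h y = 0)
    (hfh : ∀ y, |(f y : ℝ) - h y| < ε) :
    |(∫⁻ y, (f y : ℝ≥0∞) ∂μ.toMeasure).toReal - (∫⁻ y, (h y : ℝ≥0∞) ∂μ.toMeasure).toReal| ≤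
      ε * (∫⁻ y, (ramp (2 / x).toNNReal (half_pos hx) y : ℝ≥0∞) ∂μ.toMeasure).toReal := by
  set g := ramp (2 / x).toNNReal (half_pos hx) with hgdef
  have key : ∀ f h : C_c(E, ℝ≥0), (∀ y : E, (y : ℝ) < x → f y = 0) →
      (∀ y, (f y : ℝ) - h y < ε) →
      (∫⁻ y, (f y : ℝ≥0∞) ∂μ.toMeasure).toReal ≤ (∫⁻ y, (h y : ℝ≥0∞) ∂μ.toMeasure).toReal +
        ε * (∫⁻ y, (g y : ℝ≥0∞) ∂μ.toMeasure).toReal := by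
    intro f h hf hfh
    have hg1 : ∀ y : E, x ≤ y → (1 : ℝ) ≤ g y := by
      intro y hy
      rw [hgdef, ramp_apply, NNReal.coe_mul, Real.coe_toNNReal _ (by positivity),
        Real.coe_toNNReal _ (by linarith)]
      calc (1 : ℝ) = 2 / x * (x / 2) := by field_simp
        _ ≤ _ := by gcongr; linarith
    have hle : ∀ y, (f y : ℝ≥0∞) ≤ h y + ENNReal.ofReal ε * g y := by
      intro y
      have : f y ≤ h y + ε.toNNReal * g y := by
        by_cases hy : x ≤ (y : ℝ)
        · rw [← NNReal.coe_le_coe]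
          push_cast
          rw [Real.coe_toNNReal _ hε.le]
          have h1 := hfh y
          have h2 := hg1 y hy
          nlinarith
        · rw [hf y (not_le.1 hy)]
          exact zero_le
      rw [ENNReal.ofReal]
      exact_mod_cast this
    have hm : ∀ f : C_c(E, ℝ≥0), Measurable fun y => (f y : ℝ≥0∞) := fun f =>
      (ENNReal.continuous_coe.comp f.continuous).measurable
    have hint : ∫⁻ y, (f y : ℝ≥0∞) ∂μ.toMeasure ≤ ∫⁻ y, (h y : ℝ≥0∞) ∂μ.toMeasure +
        ENNReal.ofReal ε * ∫⁻ y, (g y : ℝ≥0∞) ∂μ.toMeasure := by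
      rw [← lintegral_const_mul _ (hm g), ← lintegral_add_left (hm h)]
      exact lintegral_mono hle
    have hfin := lintegral_compactlySupported_lt_top μ
    have hfg : ENNReal.ofReal ε * ∫⁻ y, (g y : ℝ≥0∞) ∂μ.toMeasure ≠ ∞ :=
      (ENNReal.mul_lt_top ENNReal.ofReal_lt_top (hfin g)).ne
    have := ENNReal.toReal_mono (ENNReal.add_ne_top.2 ⟨(hfin h).ne, hfg⟩) hint
    rwa [ENNReal.toReal_add (hfin h).ne hfg, ENNReal.toReal_mul,
      ENNReal.toReal_ofReal hε.le] at this
  have h1 := key f h hf fun y => (abs_lt.1 (hfh y)).2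
  have h2 := key h f hh fun y => by have := (abs_lt.1 (hfh y)).1; linarith
  rw [abs_le]
  constructor <;> linarith

/-- Countable dense families on the sets `[1/(j+1), 1]`, together with the ramps controlling the
approximation error, already generate the vague topology. Second countability follows; it makes
addition Borel measurable on the product, which convolution needs. -/
theorem exists_countable_isInducing :
    ∃ S : Set C_c(E, ℝ≥0), S.Countable ∧
      IsInducing fun (μ : PointMeasure E) (f : S) => ∫⁻ y, (f.1 y : ℝ≥0∞) ∂μ.toMeasure := by
  have hpos : ∀ j : ℕ, 0 < 1 / ((j : ℝ) + 1) := fun j => Nat.one_div_pos_of_nat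
  choose D hDc hD0 hD using fun j : ℕ => exists_countable_dense_supported (hpos j)
  let g : ℕ → C_c(E, ℝ≥0) := fun j => ramp (2 / (1 / ((j : ℝ) + 1))).toNNReal (half_pos (hpos j))
  refine ⟨(⋃ j, D j) ∪ Set.range g, (Set.countable_iUnion hDc).union (Set.countable_range g), ?_⟩
  set S := (⋃ j, D j) ∪ Set.range g with hS
  set Φ : PointMeasure E → S → ℝ≥0∞ := fun μ f => ∫⁻ y, (f.1 y : ℝ≥0∞) ∂μ.toMeasure with hΦ
  refine ⟨le_antisymm ?_ ?_⟩
  · exact continuous_iff_le_induced.1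
      (continuous_pi fun f => continuous_lintegral_pointMeasure f.1)
  · refine le_iInf fun f => continuous_iff_le_induced.1 ?_
    -- It must be shown that every `μ ↦ μ(f)` is continuous for the topology `τ` generated by `S`
    -- alone.
    let τ : TopologicalSpace (PointMeasure E) := TopologicalSpace.induced Φ inferInstance
    have hc : ∀ h ∈ S, Continuous[τ, _]
        fun μ : PointMeasure E => (∫⁻ y, (h y : ℝ≥0∞) ∂μ.toMeasure).toReal := by
      intro h hh
      rw [continuous_iff_continuousAt]
      intro μ
      refine (ENNReal.tendsto_toReal (lintegral_compactlySupported_lt_top μ h).ne).comp ?_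
      have h1 : Continuous[τ, _] Φ := continuous_induced_dom
      exact ((continuous_apply (⟨h, hh⟩ : S)).comp h1).continuousAt
    obtain ⟨j, hj⟩ := exists_supported f
    have hcont : Continuous[τ, _]
        fun μ : PointMeasure E => (∫⁻ y, (f y : ℝ≥0∞) ∂μ.toMeasure).toReal := by
      refine continuous_of_forall_approx (hc (g j) (Or.inr ⟨j, rfl⟩)) fun ε hε => ?_
      obtain ⟨h, hhD, hfh⟩ := hD j f hj ε hε
      exact ⟨_, hc h (Or.inl (Set.mem_iUnion.2 ⟨j, hhD⟩)),
        fun μ => abs_toReal_lintegral_sub_le (hpos j) μ hε hj (hD0 j h hhD) hfh⟩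
    have := ENNReal.continuous_ofReal.comp hcont
    convert! this using 2 with μ
    exact (ENNReal.ofReal_toReal (lintegral_compactlySupported_lt_top μ f).ne).symm

instance : SecondCountableTopology (PointMeasure E) := by
  obtain ⟨S, hS, hind⟩ := exists_countable_isInducing
  have := hS.to_subtype
  exact hind.secondCountableTopology

instance : MeasurableAdd₂ (PointMeasure E) := ContinuousAdd.measurableMul₂

/-! ### Measurability of the evaluation maps -/

theorem ramp_pos_iff {x : ℝ} (hx : 0 < x) (y : E) : 0 < (ramp 1 hx y : ℝ≥0∞) ↔ x < y := by
  simp [ramp_apply]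

theorem lintegral_ramp_pos_iff {x : ℝ} (hx : 0 < x) (μ : Measure E) :
    0 < ∫⁻ y, (ramp 1 hx y : ℝ≥0∞) ∂μ ↔ 0 < μ {y : E | x < y} := by
  have hm : Measurable fun y => (ramp 1 hx y : ℝ≥0∞) :=
    (ENNReal.continuous_coe.comp (ramp 1 hx).continuous).measurable
  rw [lintegral_pos_iff_support hm]
  have : (Function.support fun y => (ramp 1 hx y : ℝ≥0∞)) = {y : E | x < y} := by
    ext y
    rw [Function.mem_support, ← pos_iff_ne_zero, ramp_pos_iff]
    rfl
  rw [this]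

theorem measurableSet_setOf_lt (x : ℝ) : MeasurableSet {y : E | x < y} :=
  measurableSet_lt measurable_const measurable_subtype_coe

theorem mem_exceedSet_iff (x : ℝ) (μ : PointMeasure E) :
    μ ∈ exceedSet x ↔ 0 < μ.toMeasure {y : E | x < y} := by
  have : {y : E | x < |(y : ℝ)|} = {y : E | x < y} := by
    ext y
    simp [abs_of_pos y.2.1]
  unfold exceedSet
  rw [this]
  refine ⟨fun h => h.2, fun h => ⟨?_, h⟩⟩
  rintro rfl
  simp at h

theorem isOpen_exceedSet {x : ℝ} (hx : 0 < x) : IsOpen (exceedSet x) := by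
  have : exceedSet x = {μ | 0 < ∫⁻ y, (ramp 1 hx y : ℝ≥0∞) ∂μ.toMeasure} := by
    ext μ
    rw [mem_exceedSet_iff, ← lintegral_ramp_pos_iff hx]
    rfl
  rw [this]
  exact isOpen_lt continuous_const (continuous_lintegral_pointMeasure _)

theorem measurableSet_exceedSet {x : ℝ} (hx : 0 < x) : MeasurableSet (exceedSet x) :=
  (isOpen_exceedSet hx).measurableSet

/-- The indicator of `(x, 1]` is the increasing limit of the test functions `min 1 (n * ramp)`. -/
theorem measurable_measure_setOf_lt {x : ℝ} (hx : 0 < x) :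
    Measurable fun μ : PointMeasure E => μ.toMeasure {y : E | x < y} := by
  have key : ∀ μ : PointMeasure E, μ.toMeasure {y : E | x < y} =
      ⨆ n : ℕ, ∫⁻ y, (min 1 (n * ramp 1 hx y) : ℝ≥0∞) ∂μ.toMeasure := by
    intro μ
    rw [← lintegral_iSup]
    · rw [← lintegral_indicator_one (measurableSet_setOf_lt x)]
      refine lintegral_congr fun y => ?_
      by_cases hy : x < y
      · rw [Set.indicator_of_mem (by exact hy)]
        refine le_antisymm ?_ (iSup_le fun n => min_le_left _ _)
        obtain ⟨n, hn⟩ := ENNReal.exists_nat_mul_gt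
          ((ramp_pos_iff hx y).2 hy).ne' (ENNReal.one_ne_top)
        exact le_iSup_of_le n (le_min le_rfl hn.le)
      · rw [Set.indicator_of_notMem (by exact hy)]
        have : (ramp 1 hx y : ℝ≥0∞) = 0 := by
          by_contra h
          exact hy ((ramp_pos_iff hx y).1 (pos_iff_ne_zero.2 h))
        simp [this]
    · intro n
      have := (ENNReal.continuous_coe.comp (ramp 1 hx).continuous).measurable
      exact measurable_const.min (this.const_mul _)
    · intro n m hnm y
      dsimp only
      gcongr
  simp_rw [key]
  refine Measurable.iSup fun n => ?_
  let g : C_c(E, ℝ≥0) :=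
    { toFun := fun y => min 1 (n * ramp 1 hx y)
      continuous_toFun := by fun_prop
      hasCompactSupport' := HasCompactSupport.intro (isCompact_setOf_le hx) fun y hy => by
        simp only [Set.mem_ofPred_eq, not_le] at hy
        simp [ramp_apply, Real.toNNReal_of_nonpos (sub_nonpos.2 hy.le)] }
  have := (continuous_lintegral_pointMeasure g).measurable
  convert! this using 3 with μ y

theorem setOf_lt_subset_setOf_le (x : ℝ) : {y : E | x < y} ⊆ {y : E | x ≤ y} :=
  fun y (hy : x < y) => hy.le

theorem PointMeasure.measure_setOf_lt_lt_top (μ : PointMeasure E) {x : ℝ} (hx : 0 < x) :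
    μ.toMeasure {y : E | x < y} < ∞ := by
  have h := (isCompact_setOf_le hx)
  refine (measure_mono (setOf_lt_subset_setOf_le x)).trans_lt
    (μ.measure_lt_top h.isClosed.measurableSet ?_)
  rwa [h.isClosed.closure_eq]

/-- Restricted to `(x, 1]` the measures are finite, so it suffices to evaluate them on the π-system
of the upper rays. -/
theorem measurable_restrict_toMeasure {x : ℝ} (hx : 0 < x) :
    Measurable fun μ : PointMeasure E => μ.toMeasure.restrict {y : E | x < y} := by
  have : ∀ μ : PointMeasure E, IsFiniteMeasure (μ.toMeasure.restrict {y : E | x < y}) := fun μ =>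
    ⟨by simpa using μ.measure_setOf_lt_lt_top hx⟩
  refine Measurable.measure_of_isPiSystem (S := Set.range Set.Ioi) ?_ isPiSystem_Ioi ?_ ?_
  · rw [← borel_eq_generateFrom_Ioi E]
    exact BorelSpace.measurable_eq
  · rintro _ ⟨z, rfl⟩
    simp_rw [Measure.restrict_apply measurableSet_Ioi]
    have : Set.Ioi z ∩ {y : E | x < y} = {y : E | max (z : ℝ) x < y} := by
      ext y
      simp
    rw [this]
    exact measurable_measure_setOf_lt (lt_max_of_lt_right hx)
  · simpa using measurable_measure_setOf_lt hx

theorem measurable_toMeasure : Measurable (PointMeasure.toMeasure : PointMeasure E → Measure E) := by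
  refine Measure.measurable_of_measurable_coe _ fun B hB => ?_
  let A : ℕ → Set E := fun j => {y : E | 1 / ((j : ℝ) + 1) < y}
  have hpos : ∀ j : ℕ, 0 < 1 / ((j : ℝ) + 1) := fun j => Nat.one_div_pos_of_nat
  have hA : Monotone A := by
    intro i j hij y (hy : 1 / ((i : ℝ) + 1) < y)
    have h1 : 1 / ((j : ℝ) + 1) ≤ 1 / ((i : ℝ) + 1) := by gcongr
    exact h1.trans_lt hy
  have hU : ⋃ j, A j = Set.univ := Set.eq_univ_of_forall fun y =>
    Set.mem_iUnion.2 (exists_nat_one_div_lt y.2.1)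
  have key : ∀ μ : PointMeasure E, μ.toMeasure B = ⨆ j, μ.toMeasure.restrict (A j) B := by
    intro μ
    simp_rw [Measure.restrict_apply hB]
    rw [← Monotone.measure_iUnion (fun i j hij => Set.inter_subset_inter_right B (hA hij)),
      ← Set.inter_iUnion, hU, Set.inter_univ]
  simp_rw [key]
  exact Measurable.iSup fun j =>
    (Measure.measurable_coe hB).comp (measurable_restrict_toMeasure (hpos j))

theorem measurable_lintegral_pointMeasure {f : E → ℝ≥0} (hf : Measurable f) :
    Measurable fun μ : PointMeasure E => ∫⁻ y, (f y : ℝ≥0∞) ∂μ.toMeasure :=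
  (Measure.measurable_lintegral hf.coe_nnreal_ennreal).comp measurable_toMeasure

theorem lt_maxPoint_iff {x : ℝ} (hx : 0 < x) (μ : PointMeasure E) :
    x < maxPoint μ ↔ ∃ y : E, 0 < μ.toMeasure {y} ∧ x < y := by
  unfold maxPoint
  constructor
  · intro h
    obtain ⟨t, ⟨y, hy, rfl⟩, ht⟩ : ∃ t ∈ {t : ℝ | ∃ y : E, 0 < μ.toMeasure {y} ∧ t = |(y : ℝ)|},
        x < t := by
      apply exists_lt_of_lt_csSup _ h
      -- Without atoms the supremum is `sSup ∅ = 0`, which is not above `x > 0`.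
      by_contra hne
      rw [Set.not_nonempty_iff_eq_empty.1 hne, Real.sSup_empty] at h
      exact absurd h (not_lt.2 hx.le)
    exact ⟨y, hy, by rwa [abs_of_pos y.2.1] at ht⟩
  · rintro ⟨y, hy, hxy⟩
    refine lt_csSup_of_lt ⟨1, ?_⟩ ⟨y, hy, rfl⟩ (by rwa [abs_of_pos y.2.1])
    rintro _ ⟨z, -, rfl⟩
    rw [abs_of_pos z.2.1]
    exact z.2.2

theorem toE_of_mem {t : ℝ} (h : t ∈ Set.Ioc (0 : ℝ) 1) : toE t = ⟨t, h⟩ := dif_pos h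

theorem coe_toE {t : ℝ} (h : t ∈ Set.Ioc (0 : ℝ) 1) : (toE t : ℝ) = t := by
  rw [toE_of_mem h]

theorem measurable_toE : Measurable toE := by
  classical
  exact Measurable.dite (s := Set.Ioc (0 : ℝ) 1) (f := fun t => t)
    (g := fun _ => ⟨1, by norm_num⟩) measurable_id measurable_const measurableSet_Ioc

/-! ### The function `expNeg` -/

@[simp] theorem expNeg_zero : expNeg 0 = 1 := by simp [expNeg]

theorem expNeg_add (s t : ℝ≥0∞) : expNeg (s + t) = expNeg s * expNeg t := by
  unfold expNeg
  rw [← EReal.exp_add, EReal.coe_ennreal_add, EReal.neg_add]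
  · rfl
  · left; simp
  · right; simp

theorem expNeg_le_one (t : ℝ≥0∞) : expNeg t ≤ 1 := by
  unfold expNeg
  rw [EReal.exp_le_one_iff, EReal.neg_le_zero]
  exact EReal.coe_ennreal_nonneg t

theorem expNeg_antitone : Antitone expNeg := fun s t h => by
  unfold expNeg
  simpa using h

theorem measurable_expNeg : Measurable expNeg := expNeg_antitone.measurable

theorem expNeg_coe (t : ℝ≥0) : expNeg t = ENNReal.ofReal (Real.exp (-t)) := by
  unfold expNeg
  rw [← EReal.exp_coe]
  rfl

/-! ### Compound Poisson distributions -/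

section CompoundPoisson

variable {M : Type*} [AddCommMonoid M] [MeasurableSpace M]

/-- The convolution powers of a measure. -/
def convPow (Q : Measure M) : ℕ → Measure M
  | 0 => Measure.dirac 0
  | n + 1 => Q ∗ convPow Q n

/-- The compound Poisson distribution with intensity `r` and jump distribution `Q`. -/
def compoundPoisson (r : ℝ≥0) (Q : Measure M) : Measure M :=
  (poissonMeasure r).bind (convPow Q)

theorem lintegral_compoundPoisson (Q : Measure M) (r : ℝ≥0) {f : M → ℝ≥0∞} (hf : Measurable f) :
    ∫⁻ x, f x ∂compoundPoisson r Q = ∫⁻ n, ∫⁻ x, f x ∂convPow Q n ∂poissonMeasure r :=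
  Measure.lintegral_bind Measurable.of_discrete.aemeasurable hf.aemeasurable

theorem compoundPoisson_zero (Q : Measure M) : compoundPoisson 0 Q = Measure.dirac 0 := by
  refine Measure.ext_of_lintegral _ fun f hf => ?_
  rw [lintegral_compoundPoisson Q 0 hf, poissonMeasure, lintegral_sum_measure, tsum_eq_single 0]
  · simp [convPow]
  · intro n hn
    simp [hn]

variable [MeasurableAdd₂ M] (Q : Measure M) [IsProbabilityMeasure Q]

instance isProbabilityMeasure_convPow (n : ℕ) : IsProbabilityMeasure (convPow Q n) := by
  induction n with
  | zero => exact inferInstanceAs (IsProbabilityMeasure (Measure.dirac 0))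
  | succ n ih => exact inferInstanceAs (IsProbabilityMeasure (Q ∗ convPow Q n))

theorem convPow_add (m n : ℕ) : convPow Q (m + n) = convPow Q m ∗ convPow Q n := by
  induction m with
  | zero => simp [convPow]
  | succ m ih =>
    rw [Nat.succ_add]
    change Q ∗ convPow Q (m + n) = (Q ∗ convPow Q m) ∗ convPow Q n
    rw [ih, Measure.conv_assoc]

instance isProbabilityMeasure_compoundPoisson (r : ℝ≥0) :
    IsProbabilityMeasure (compoundPoisson r Q) :=
  ⟨by
    rw [← lintegral_one]
    exact (lintegral_compoundPoisson Q r measurable_const).trans (by simp)⟩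

/-- Independent Poisson numbers of jumps add up to a Poisson number, and convolution powers add
their exponents. -/
theorem compoundPoisson_conv (r s : ℝ≥0) :
    compoundPoisson r Q ∗ compoundPoisson s Q = compoundPoisson (r + s) Q := by
  refine Measure.ext_of_lintegral _ fun f hf => ?_
  have hinner : Measurable fun x => ∫⁻ y, f (x + y) ∂compoundPoisson s Q :=
    (hf.comp measurable_add).lintegral_prod_right'
  rw [Measure.lintegral_conv hf, lintegral_compoundPoisson Q r hinner,
    lintegral_compoundPoisson Q _ hf, ← poissonMeasure_conv_poissonMeasure,
    Measure.lintegral_conv Measurable.of_discrete]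
  refine lintegral_congr fun n => ?_
  simp_rw [convPow_add, Measure.lintegral_conv hf]
  have hmeas : Measurable (Function.uncurry fun (m : ℕ) (x : M) =>
      ∫⁻ y, f (x + y) ∂convPow Q m) :=
    measurable_from_prod_countable_right fun m => by
      change Measurable fun x => ∫⁻ y, f (x + y) ∂convPow Q m
      exact (hf.comp measurable_add).lintegral_prod_right'
  rw [lintegral_lintegral_swap hmeas.aemeasurable]
  exact lintegral_congr fun x => lintegral_compoundPoisson Q s (hf.comp (measurable_const_add x))

theorem lintegral_convPow {e : M → ℝ≥0∞} (he : Measurable e) (h0 : e 0 = 1)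
    (hadd : ∀ x y, e (x + y) = e x * e y) (n : ℕ) :
    ∫⁻ x, e x ∂convPow Q n = (∫⁻ x, e x ∂Q) ^ n := by
  induction n with
  | zero => simp [convPow, lintegral_dirac' _ he, h0]
  | succ n ih =>
    change ∫⁻ x, e x ∂(Q ∗ convPow Q n) = _
    rw [Measure.lintegral_conv he]
    simp_rw [hadd, lintegral_const_mul _ he, lintegral_mul_const _ he, ih, pow_succ']

theorem lintegral_pow_poissonMeasure (r : ℝ≥0) {L : ℝ≥0∞} (hL : L ≤ 1) :
    ∫⁻ n, L ^ n ∂poissonMeasure r = expNeg (r * (1 - L)) := by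
  lift L to ℝ≥0 using (hL.trans_lt ENNReal.one_lt_top).ne
  have hL' : L ≤ 1 := by exact_mod_cast hL
  have hsum : HasSum (fun n : ℕ => Real.exp (-r) * r ^ n / n.factorial * (L : ℝ) ^ n)
      (Real.exp (-r) * Real.exp (r * L)) := by
    convert! (NormedSpace.expSeries_div_hasSum_exp (r * L : ℝ)).mul_left (Real.exp (-r)) using 1
    · ext n
      rw [mul_pow]
      ring
    · rw [Real.exp_eq_exp_ℝ]
  rw [poissonMeasure, lintegral_sum_measure]
  have : (r : ℝ≥0∞) * (1 - L) = ((r * (1 - L) : ℝ≥0) : ℝ≥0∞) := by push_cast; rfl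
  rw [this, expNeg_coe]
  push_cast [NNReal.coe_sub hL']
  rw [show -((r : ℝ) * (1 - L)) = -r + r * L by ring, Real.exp_add, ← hsum.tsum_eq,
    ENNReal.ofReal_tsum_of_nonneg (fun n => by positivity) hsum.summable]
  congr 1
  ext n
  rw [lintegral_smul_measure, lintegral_dirac, smul_eq_mul,
    ENNReal.ofReal_mul (p := Real.exp (-r) * r ^ n / n.factorial) (by positivity),
    ENNReal.ofReal_pow (by positivity), ENNReal.ofReal_coe_nnreal]

theorem map_finset_sum_pi_compoundPoisson {ι : Type*} [Fintype ι] (r : ℝ≥0) (s : Finset ι) :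
    (Measure.pi fun _ : ι => compoundPoisson r Q).map (fun ω => ∑ i ∈ s, ω i) =
      compoundPoisson (s.card * r) Q := by
  classical
  have hind : iIndepFun (fun (i : ι) (ω : ι → M) => ω i)
      (Measure.pi fun _ : ι => compoundPoisson r Q) :=
    iIndepFun_pi (X := fun _ => id) fun _ => aemeasurable_id
  induction s using Finset.induction_on with
  | empty => simp [compoundPoisson_zero, Measure.map_const]
  | insert i s hi ih =>
    have h := hind.indepFun_finsetSum_of_notMem (fun i => measurable_pi_apply i) hi
    have e1 : (∑ j ∈ s, fun ω : ι → M => ω j) = fun ω => ∑ j ∈ s, ω j := by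
      ext ω
      simp
    rw [e1] at h
    have := h.map_add_eq_map_conv_map
      (Finset.measurable_sum s fun j _ => measurable_pi_apply j) (measurable_pi_apply i)
    rw [ih, (measurePreserving_eval _ i).map_eq, compoundPoisson_conv] at this
    rw [Finset.card_insert_of_notMem hi]
    push_cast
    rw [add_mul, one_mul, ← this]
    congr 1
    ext ω
    simp [Finset.sum_insert hi, add_comm]

end CompoundPoisson

/-- The `m` summands are compound Poisson of intensity `r / m`, realised as the coordinates of a
product space. -/
theorem infinitelyDivisible_compoundPoisson (r : ℝ≥0) (Q : Measure (PointMeasure E))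
    [IsProbabilityMeasure Q] : InfinitelyDivisible (compoundPoisson r Q) id := by
  intro m hm
  refine ⟨Fin m → PointMeasure E, inferInstance,
    Measure.pi fun _ => compoundPoisson (r / m) Q, inferInstance, fun i ω => ω i,
    fun i => measurable_pi_apply i, iIndepFun_pi (X := fun _ => id) fun _ => aemeasurable_id,
    fun i j => ⟨(measurable_pi_apply i).aemeasurable, (measurable_pi_apply j).aemeasurable, ?_⟩,
    ⟨aemeasurable_id, ?_, ?_⟩⟩
  · rw [(measurePreserving_eval _ i).map_eq, (measurePreserving_eval _ j).map_eq]
  · exact (Finset.measurable_sum _ fun j _ => measurable_pi_apply j).aemeasurable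
  · rw [Measure.map_id, map_finset_sum_pi_compoundPoisson]
    congr 1
    have : (m : ℝ≥0) ≠ 0 := by positivity
    rw [Finset.card_univ, Fintype.card_fin]
    field_simp

/-- Given `n` jumps, the multiplicative functional `e^{-μ(f)}` has mean `L ^ n`, where `L` is its
mean under `Q`; averaging over the Poisson number gives `e^{-r (1 - L)}`. -/
theorem isCanonicalMeasure_compoundPoisson (r : ℝ≥0) (Q : Measure (PointMeasure E))
    [IsProbabilityMeasure Q] (h0 : Q {0} = 0) :
    IsCanonicalMeasure (compoundPoisson r Q) id ((r : ℝ≥0∞) • Q) where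
  null := by simp [h0]
  lintegral_lt_top B _ _ := by
    calc _ ≤ ∫⁻ _, 1 ∂((r : ℝ≥0∞) • Q) := lintegral_mono fun μ => tsub_le_self
      _ < ∞ := by simp
  laplace_eq f hf := by
    set e : PointMeasure E → ℝ≥0∞ := fun μ => expNeg (∫⁻ y, (f y : ℝ≥0∞) ∂μ.toMeasure) with he
    have hem : Measurable e := measurable_expNeg.comp (measurable_lintegral_pointMeasure hf)
    have hL : ∫⁻ μ, e μ ∂Q ≤ 1 := by
      calc ∫⁻ μ, e μ ∂Q ≤ ∫⁻ _, 1 ∂Q := lintegral_mono fun μ => expNeg_le_one _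
        _ = 1 := by simp
    change ∫⁻ μ, e μ ∂compoundPoisson r Q = expNeg (∫⁻ μ, (1 - e μ) ∂((r : ℝ≥0∞) • Q))
    rw [lintegral_compoundPoisson Q r hem]
    simp_rw [lintegral_convPow Q hem (by simp [he])
      (fun μ ν => by simp [he, lintegral_add_measure, expNeg_add])]
    rw [lintegral_pow_poissonMeasure r hL, lintegral_smul_measure,
      lintegral_sub hem (hL.trans_lt ENNReal.one_lt_top).ne
        (Eventually.of_forall fun μ => expNeg_le_one _)]
    simp

/-! ### Exceedance counts and the cluster size distribution -/

section

variable {Ω : Type*}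

/-- The number of the exceedances of the level `t` at the times in `J`. -/
def exceedCount (ξ : ℕ → Ω → ℝ) (t : ℝ) (J : Finset ℕ) (ω : Ω) : ℕ :=
  ∑ j ∈ J, if t < ξ j ω then 1 else 0

theorem one_le_exceedCount_iff (ξ : ℕ → Ω → ℝ) (t : ℝ) (J : Finset ℕ) (ω : Ω) :
    1 ≤ exceedCount ξ t J ω ↔ ∃ j ∈ J, t < ξ j ω := by
  rw [Nat.one_le_iff_ne_zero, exceedCount, Ne, Finset.sum_eq_zero_iff]
  simp

theorem blockExceeds_eq (ξ : ℕ → Ω → ℝ) (u : ℕ → ℝ) (k : ℕ → ℕ) (n : ℕ) :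
    blockExceeds ξ u k n = {ω | exceedCount ξ (u n) (block k n 1) ω ∈ Set.Ici 1} := by
  ext ω
  simp only [blockExceeds, Set.mem_ofPred_eq, Set.mem_Ici, one_le_exceedCount_iff,
    Finset.lt_sup_iff, EReal.coe_lt_coe_iff]

variable [MeasurableSpace Ω]

theorem measurable_exceedCount {ξ : ℕ → Ω → ℝ} (hξ : ∀ j, 1 ≤ j → Measurable (ξ j)) (t : ℝ)
    (h r : ℕ) : Measurable (exceedCount ξ t (Finset.Ioc h r)) := by
  refine Finset.measurable_sum _ fun j hj => Measurable.ite ?_ measurable_const measurable_const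
  exact measurableSet_lt measurable_const (hξ j (by have := Finset.mem_Ioc.1 hj; omega))

theorem sum_Ioc_add_eq_sum_range (f : ℕ → ℕ) (h r : ℕ) :
    ∑ j ∈ Finset.Ioc h (h + r), f j = ∑ j ∈ Finset.range r, f (j + 1 + h) := by
  refine Finset.sum_nbij' (fun j => j - 1 - h) (fun j => j + 1 + h) ?_ ?_ ?_ ?_ ?_
  · intro j hj; simp at hj ⊢; omega
  · intro j hj; simp at hj ⊢; omega
  · intro j hj; simp at hj ⊢; omega
  · intro j hj; simp
  · intro j hj
    rw [Finset.mem_Ioc] at hj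
    congr 1
    omega

theorem StationarySeq.measure_exceedCount {P : Measure Ω} {ξ : ℕ → Ω → ℝ}
    (hstat : StationarySeq P ξ) (t : ℝ) (h r : ℕ) (S : Set ℕ) :
    P {ω | exceedCount ξ t (Finset.Ioc h (h + r)) ω ∈ S} =
      P {ω | exceedCount ξ t (Finset.Ioc 0 r) ω ∈ S} := by
  let g : (ℕ → ℝ) → ℕ := fun x => ∑ j ∈ Finset.range r, if t < x j then 1 else 0
  have hg : Measurable g := Finset.measurable_sum _ fun j _ => Measurable.ite
    (measurableSet_lt measurable_const (measurable_pi_apply j)) measurable_const measurable_const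
  have := ((hstat h).comp hg).measure_mem_eq (MeasurableSet.of_discrete (s := S))
  have h1 : ∀ h ω, exceedCount ξ t (Finset.Ioc h (h + r)) ω = g fun j => ξ (j + 1 + h) ω :=
    fun h ω => sum_Ioc_add_eq_sum_range (fun j => if t < ξ j ω then 1 else 0) h r
  have h0 := h1 0
  simp only [zero_add, add_zero] at h0
  simp_rw [h1, h0]
  exact this.symm

theorem block_eq (k : ℕ → ℕ) (n : ℕ) {i : ℕ} (hi : 1 ≤ i) :
    block k n i = Finset.Ioc ((i - 1) * (n / k n)) ((i - 1) * (n / k n) + n / k n) := by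
  obtain ⟨i, rfl⟩ := Nat.exists_eq_add_of_le' hi
  simp [block, add_mul]

/-- This replaces every block by the first one, the only block about which the hypotheses on maxima
and cluster sizes speak. -/
theorem StationarySeq.measure_exceedCount_block {P : Measure Ω} {ξ : ℕ → Ω → ℝ}
    (hstat : StationarySeq P ξ) (t : ℝ) (k : ℕ → ℕ) (n : ℕ) {i : ℕ} (hi : 1 ≤ i) (S : Set ℕ) :
    P {ω | exceedCount ξ t (block k n i) ω ∈ S} =
      P {ω | exceedCount ξ t (block k n 1) ω ∈ S} := by
  rw [block_eq k n hi, hstat.measure_exceedCount, block_eq k n le_rfl]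
  simp

theorem StationarySeq.measure_exceed {P : Measure Ω} {ξ : ℕ → Ω → ℝ}
    (hstat : StationarySeq P ξ) (t : ℝ) {j : ℕ} (hj : 1 ≤ j) :
    P {ω | t < ξ j ω} = P {ω | t < ξ 1 ω} := by
  obtain ⟨j, rfl⟩ := Nat.exists_eq_add_of_le' hj
  have h : ∀ j, {ω | t < ξ (j + 1) ω} = {ω | exceedCount ξ t (Finset.Ioc j (j + 1)) ω ∈ Set.Ici 1} :=
    fun j => by
      ext ω
      simp only [Set.mem_ofPred_eq, Set.mem_Ici, one_le_exceedCount_iff]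
      refine ⟨fun h => ⟨j + 1, by simp, h⟩, ?_⟩
      rintro ⟨i, hi, h⟩
      rw [Finset.mem_Ioc] at hi
      rwa [show i = j + 1 by omega] at h
  rw [h j, hstat.measure_exceedCount, ← h 0]

theorem measurable_exceedCount_block {ξ : ℕ → Ω → ℝ} (hξ : ∀ j, 1 ≤ j → Measurable (ξ j)) (t : ℝ)
    (k : ℕ → ℕ) (n i : ℕ) : Measurable (exceedCount ξ t (block k n i)) :=
  measurable_exceedCount hξ t _ _

theorem measurableSet_blockExceeds {ξ : ℕ → Ω → ℝ} (hξ : ∀ j, 1 ≤ j → Measurable (ξ j))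
    (u : ℕ → ℝ) (k : ℕ → ℕ) (n : ℕ) : MeasurableSet (blockExceeds ξ u k n) := by
  rw [blockExceeds_eq]
  exact measurable_exceedCount_block hξ _ k n 1 .of_discrete

theorem lintegral_exceedCount_Ioc {P : Measure Ω} {ξ : ℕ → Ω → ℝ}
    (hξ : ∀ j, 1 ≤ j → Measurable (ξ j)) (hstat : StationarySeq P ξ) (t : ℝ) (r : ℕ) :
    ∫⁻ ω, (exceedCount ξ t (Finset.Ioc 0 r) ω : ℝ≥0∞) ∂P = r * P {ω | t < ξ 1 ω} := by
  have hset : ∀ j ∈ Finset.Ioc 0 r, MeasurableSet {ω | t < ξ j ω} := fun j hj =>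
    measurableSet_lt measurable_const (hξ j (Finset.mem_Ioc.1 hj).1)
  have h1 : ∀ ω, (exceedCount ξ t (Finset.Ioc 0 r) ω : ℝ≥0∞) =
      ∑ j ∈ Finset.Ioc 0 r, {ω | t < ξ j ω}.indicator 1 ω := fun ω => by
    rw [exceedCount]
    push_cast
    exact Finset.sum_congr rfl fun j _ => by simp [Set.indicator_apply]
  simp_rw [h1]
  rw [lintegral_finsetSum _ fun j hj => measurable_one.indicator (hset j hj),
    Finset.sum_congr rfl fun j hj => (lintegral_indicator_one (hset j hj)).trans
      (hstat.measure_exceed t (Finset.mem_Ioc.1 hj).1)]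
  simp

theorem clusterProb_nonneg (P : Measure Ω) (ξ : ℕ → Ω → ℝ) (u : ℕ → ℝ) (k : ℕ → ℕ) (n m : ℕ) :
    0 ≤ clusterProb P ξ u k n m := measureReal_nonneg

theorem measureReal_blockExceeds_mul_clusterProb {P : Measure Ω} [IsProbabilityMeasure P]
    {ξ : ℕ → Ω → ℝ} (hξ : ∀ j, 1 ≤ j → Measurable (ξ j)) (u : ℕ → ℝ) (k : ℕ → ℕ) (n : ℕ) {m : ℕ}
    (hm : 1 ≤ m) :
    P.real (blockExceeds ξ u k n) * clusterProb P ξ u k n m =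
      P.real {ω | exceedCount ξ (u n) (block k n 1) ω = m} := by
  have hsub : {ω | exceedCount ξ (u n) (block k n 1) ω = m} ⊆ blockExceeds ξ u k n := by
    rw [blockExceeds_eq]
    intro ω (hω : _ = m)
    exact (by rw [hω]; exact hm : 1 ≤ exceedCount ξ (u n) (block k n 1) ω)
  have hc : clusterProb P ξ u k n m = (P.real (blockExceeds ξ u k n))⁻¹ *
      P.real {ω | exceedCount ξ (u n) (block k n 1) ω = m} := by
    rw [clusterProb, measureReal_def, cond_apply (measurableSet_blockExceeds hξ u k n),
      ENNReal.toReal_mul, ENNReal.toReal_inv]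
    congr 3
    exact Set.inter_eq_right.2 hsub
  rw [hc]
  -- If the conditioning event is null, then so is the event on the right, which it contains.
  by_cases h0 : P.real (blockExceeds ξ u k n) = 0
  · have := measureReal_mono (μ := P) hsub
    rw [h0] at this
    rw [h0, zero_mul, le_antisymm this measureReal_nonneg]
  · field_simp

/-- The cluster size probabilities, multiplied by the number of the blocks. -/
theorem tendsto_card_mul_exceedCount {P : Measure Ω} [IsProbabilityMeasure P]
    {ξ : ℕ → Ω → ℝ} (hξ : ∀ j, 1 ≤ j → Measurable (ξ j)) {u : ℕ → ℝ} {k : ℕ → ℕ} {a : ℝ}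
    (hmax : Tendsto (fun n => (k n : ℝ) * P.real (blockExceeds ξ u k n)) atTop (𝓝 a))
    {p : ℝ} {m : ℕ} (hm : 1 ≤ m)
    (hp : Tendsto (fun n => clusterProb P ξ u k n m) atTop (𝓝 p)) :
    Tendsto (fun n => (k n : ℝ) * P.real {ω | exceedCount ξ (u n) (block k n 1) ω = m}) atTop
      (𝓝 (a * p)) := by
  refine (hmax.mul hp).congr fun n => ?_
  rw [mul_assoc, measureReal_blockExceeds_mul_clusterProb hξ u k n hm]

theorem sum_measureReal_exceedCount_le {P : Measure Ω} [IsProbabilityMeasure P]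
    {ξ : ℕ → Ω → ℝ} (hξ : ∀ j, 1 ≤ j → Measurable (ξ j)) (u : ℕ → ℝ) (k : ℕ → ℕ) (n L : ℕ) :
    ∑ m ∈ Finset.range L, P.real {ω | exceedCount ξ (u n) (block k n 1) ω = m + 1} ≤
      P.real (blockExceeds ξ u k n) := by
  rw [← measureReal_biUnion_finset]
  · refine measureReal_mono (Set.iUnion₂_subset fun m _ ω (hω : _ = m + 1) => ?_)
    rw [blockExceeds_eq]
    exact (by omega : 1 ≤ exceedCount ξ (u n) (block k n 1) ω)
  · intro i _ j _ hij
    refine Set.disjoint_left.2 fun ω (hi : _ = i + 1) (hj : _ = j + 1) => hij (by omega)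
  · exact fun m _ => measurable_exceedCount_block hξ _ k n 1 (measurableSet_singleton _)

/-- The last term is Markov's bound for more than `L` exceedances in a block of `n / k n` indices.
-/
theorem measureReal_blockExceeds_le {P : Measure Ω} [IsProbabilityMeasure P]
    {ξ : ℕ → Ω → ℝ} (hξ : ∀ j, 1 ≤ j → Measurable (ξ j)) (hstat : StationarySeq P ξ)
    (u : ℕ → ℝ) (k : ℕ → ℕ) (n L : ℕ) :
    P.real (blockExceeds ξ u k n) ≤
      ∑ m ∈ Finset.range L, P.real {ω | exceedCount ξ (u n) (block k n 1) ω = m + 1} +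
        ((n / k n : ℕ) : ℝ) * P.real {ω | u n < ξ 1 ω} / (L + 1) := by
  set c := exceedCount ξ (u n) (block k n 1) with hc
  have hsub : blockExceeds ξ u k n ⊆
      (⋃ m ∈ Finset.range L, {ω | c ω = m + 1}) ∪ {ω | L + 1 ≤ c ω} := by
    rw [blockExceeds_eq]
    intro ω (hω : 1 ≤ c ω)
    by_cases h : L + 1 ≤ c ω
    · exact Or.inr h
    · refine Or.inl (Set.mem_iUnion₂.2 ⟨c ω - 1, ?_, ?_⟩)
      · simp only [Finset.mem_range]; omega
      · simp only [Set.mem_ofPred_eq]; omega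
  have hmarkov : P.real {ω | L + 1 ≤ c ω} ≤
      ((n / k n : ℕ) : ℝ) * P.real {ω | u n < ξ 1 ω} / (L + 1) := by
    have hcm : Measurable c := measurable_exceedCount_block hξ _ k n 1
    have h1 := mul_meas_ge_le_lintegral (μ := P) (f := fun ω => (c ω : ℝ≥0∞))
      (measurable_from_nat.comp hcm) ((L + 1 : ℕ) : ℝ≥0∞)
    have h2 : ∫⁻ ω, (c ω : ℝ≥0∞) ∂P = ((n / k n : ℕ) : ℝ≥0∞) * P {ω | u n < ξ 1 ω} := by
      rw [← lintegral_exceedCount_Ioc hξ hstat, hc, block_eq k n le_rfl]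
      simp
    rw [h2] at h1
    have h3 := ENNReal.toReal_mono
      (ENNReal.mul_ne_top (ENNReal.natCast_ne_top _) (measure_ne_top P _)) h1
    simp only [ENNReal.toReal_mul, ENNReal.toReal_natCast, Nat.cast_le] at h3
    rw [le_div_iff₀ (by positivity), mul_comm]
    simpa [measureReal_def] using h3
  calc P.real (blockExceeds ξ u k n)
      ≤ P.real ((⋃ m ∈ Finset.range L, {ω | c ω = m + 1}) ∪ {ω | L + 1 ≤ c ω}) :=
        measureReal_mono hsub
    _ ≤ P.real (⋃ m ∈ Finset.range L, {ω | c ω = m + 1}) + P.real {ω | L + 1 ≤ c ω} :=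
        measureReal_union_le _ _
    _ ≤ _ := add_le_add (measureReal_biUnion_finset_le _ _) hmarkov

/-- Partial sums are at most `1` by disjointness. Multiplying the Markov bound by `k n` and using `k
n * (n / k n) ≤ n` shows that at most `1 / (a (L + 1))` is missing after `L` terms. -/
theorem hasSum_cluster {P : Measure Ω} [IsProbabilityMeasure P]
    {ξ : ℕ → Ω → ℝ} (hξ : ∀ j, 1 ≤ j → Measurable (ξ j)) (hstat : StationarySeq P ξ)
    {u : ℕ → ℝ} (hu : Tendsto (fun n : ℕ => (n : ℝ) * P.real {ω | u n < ξ 1 ω}) atTop (𝓝 1))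
    {k : ℕ → ℕ} {a : ℝ} (ha : 0 < a)
    (hmax : Tendsto (fun n => (k n : ℝ) * P.real (blockExceeds ξ u k n)) atTop (𝓝 a))
    {p : ℕ → ℝ}
    (hp : ∀ m : ℕ, 1 ≤ m → Tendsto (fun n => clusterProb P ξ u k n m) atTop (𝓝 (p m))) :
    HasSum (fun m => p (m + 1)) 1 := by
  have hp0 : ∀ m, 0 ≤ p (m + 1) := fun m =>
    ge_of_tendsto' (hp (m + 1) (by omega)) fun n => clusterProb_nonneg P ξ u k n _
  rw [hasSum_iff_tendsto_nat_of_nonneg hp0]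
  have hlim : ∀ L : ℕ, Tendsto (fun n => ∑ m ∈ Finset.range L,
      (k n : ℝ) * P.real {ω | exceedCount ξ (u n) (block k n 1) ω = m + 1}) atTop
      (𝓝 (a * ∑ m ∈ Finset.range L, p (m + 1))) := fun L => by
    rw [Finset.mul_sum]
    exact tendsto_finsetSum _ fun m _ =>
      tendsto_card_mul_exceedCount hξ hmax (by omega) (hp (m + 1) (by omega))
  have hle : ∀ L : ℕ, ∑ m ∈ Finset.range L, p (m + 1) ≤ 1 := fun L => by
    have := le_of_tendsto_of_tendsto' (hlim L) hmax fun n => by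
      rw [← Finset.mul_sum]
      exact mul_le_mul_of_nonneg_left (sum_measureReal_exceedCount_le hξ u k n L)
        (Nat.cast_nonneg _)
    nlinarith
  have hge : ∀ L : ℕ, 1 - 1 / a * (1 / ((L : ℝ) + 1)) ≤ ∑ m ∈ Finset.range L, p (m + 1) := by
    intro L
    have := le_of_tendsto_of_tendsto' hmax ((hlim L).add (hu.div_const ((L : ℝ) + 1))) fun n => by
      rw [← Finset.mul_sum]
      calc (k n : ℝ) * P.real (blockExceeds ξ u k n) ≤ k n *
            (∑ m ∈ Finset.range L, P.real {ω | exceedCount ξ (u n) (block k n 1) ω = m + 1} +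
              ((n / k n : ℕ) : ℝ) * P.real {ω | u n < ξ 1 ω} / (L + 1)) :=
            mul_le_mul_of_nonneg_left (measureReal_blockExceeds_le hξ hstat u k n L)
              (Nat.cast_nonneg _)
        _ = k n * ∑ m ∈ Finset.range L,
              P.real {ω | exceedCount ξ (u n) (block k n 1) ω = m + 1} +
              ((k n * (n / k n) : ℕ) : ℝ) * P.real {ω | u n < ξ 1 ω} / (L + 1) := by
            push_cast
            ring
        _ ≤ _ := by
            gcongr
            exact Nat.mul_div_le n (k n)
    have h2 : (a : ℝ) * (1 - 1 / a * (1 / ((L : ℝ) + 1))) ≤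
        a * ∑ m ∈ Finset.range L, p (m + 1) := by
      have : a * (1 - 1 / a * (1 / ((L : ℝ) + 1))) = a - 1 / (L + 1) := by field_simp
      linarith
    exact le_of_mul_le_mul_left h2 ha
  refine tendsto_of_tendsto_of_tendsto_of_le_of_le ?_ tendsto_const_nhds hge hle
  have := (tendsto_one_div_add_atTop_nhds_zero_nat (𝕜 := ℝ)).const_mul (1 / a)
  simpa using this.const_sub 1

end

/-! ### The blocks asymptotically exhaust the indices -/

section

theorem mem_Ioc_div {j n : ℕ} (hj : 1 ≤ j) (hjn : j ≤ n) :
    (j : ℝ) / n ∈ Set.Ioc (0 : ℝ) 1 := by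
  have hn : (0 : ℝ) < n := by exact_mod_cast hj.trans hjn
  have hj' : (0 : ℝ) < j := by exact_mod_cast hj
  exact ⟨by positivity, (div_le_one hn).2 (by exact_mod_cast hjn)⟩

theorem coe_toE_div {j n : ℕ} (hj : 1 ≤ j) (hjn : j ≤ n) : (toE ((j : ℝ) / n) : ℝ) = j / n :=
  coe_toE (mem_Ioc_div hj hjn)

theorem of_mem_block {k : ℕ → ℕ} {n i j : ℕ} (hi : i ∈ Finset.Icc 1 (k n)) (hj : j ∈ block k n i) :
    (i - 1) * (n / k n) < j ∧ j ≤ i * (n / k n) ∧ j ≤ k n * (n / k n) ∧ 1 ≤ j ∧ j ≤ n := by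
  rw [Finset.mem_Icc] at hi
  rw [block, Finset.mem_Ioc] at hj
  have h1 : i * (n / k n) ≤ k n * (n / k n) := Nat.mul_le_mul_right _ hi.2
  have h2 := Nat.mul_div_le n (k n)
  omega

variable {Ω : Type*}

theorem toMeasure_exceedOn (ξ : ℕ → Ω → ℝ) (u : ℕ → ℝ) (n : ℕ) (J : Finset ℕ) (ω : Ω) :
    (exceedOn ξ u n J ω).toMeasure =
      ∑ j ∈ J, if u n < ξ j ω then Measure.dirac (toE ((j : ℝ) / n)) else 0 := by
  rw [exceedOn, PointMeasure.toMeasure_sum]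
  refine Finset.sum_congr rfl fun j _ => ?_
  split_ifs <;> simp

theorem lintegral_exceedOn (ξ : ℕ → Ω → ℝ) (u : ℕ → ℝ) (n : ℕ) (J : Finset ℕ) (ω : Ω)
    (f : E → ℝ≥0∞) :
    ∫⁻ y, f y ∂(exceedOn ξ u n J ω).toMeasure =
      ∑ j ∈ J, if u n < ξ j ω then f (toE ((j : ℝ) / n)) else 0 := by
  rw [toMeasure_exceedOn, lintegral_finsetSum_measure]
  refine Finset.sum_congr rfl fun j _ => ?_
  split_ifs <;> simp [lintegral_dirac]

theorem one_le_lintegral_exceedOn {ξ : ℕ → Ω → ℝ} {u : ℕ → ℝ} {n : ℕ} {J : Finset ℕ} {ω : Ω}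
    {f : E → ℝ≥0∞} {j : ℕ} (hj : j ∈ J) (hξ : u n < ξ j ω) (hf : 1 ≤ f (toE ((j : ℝ) / n))) :
    1 ≤ ∫⁻ y, f y ∂(exceedOn ξ u n J ω).toMeasure := by
  rw [lintegral_exceedOn]
  refine le_trans ?_ (Finset.single_le_sum (f := fun j => if u n < ξ j ω then
    f (toE ((j : ℝ) / n)) else 0) (fun _ _ => zero_le) hj)
  simpa [hξ] using hf

variable [MeasurableSpace Ω]

/-- Blocks of length zero have no exceedances, which is incompatible with a positive limit `a`. -/
theorem eventually_one_le_blockLength {P : Measure Ω} {ξ : ℕ → Ω → ℝ} {u : ℕ → ℝ} {k : ℕ → ℕ} {a : ℝ} (ha : 0 < a)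
    (hmax : Tendsto (fun n => (k n : ℝ) * P.real (blockExceeds ξ u k n)) atTop (𝓝 a)) :
    ∀ᶠ n in atTop, 1 ≤ n / k n := by
  filter_upwards [hmax.eventually (lt_mem_nhds ha)] with n hn
  by_contra h
  have h0 : n / k n = 0 := Nat.lt_one_iff.1 (not_le.1 h)
  have : blockExceeds ξ u k n = ∅ := by
    rw [blockExceeds_eq, block_eq k n le_rfl, h0]
    simp [exceedCount]
  simp [this] at hn

variable {P : Measure Ω} [IsProbabilityMeasure P]

theorem laplace_le_one (P : Measure Ω) [IsProbabilityMeasure P] (N : Ω → PointMeasure E)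
    (f : E → ℝ≥0) : laplace P N f ≤ 1 := by
  calc laplace P N f ≤ ∫⁻ _, 1 ∂P := lintegral_mono fun ω => expNeg_le_one _
    _ = 1 := by simp

theorem laplace_toReal_le_one (P : Measure Ω) [IsProbabilityMeasure P] (N : Ω → PointMeasure E)
    (f : E → ℝ≥0) : (laplace P N f).toReal ≤ 1 := by
  simpa using ENNReal.toReal_mono ENNReal.one_ne_top (laplace_le_one P N f)

theorem expNeg_one_toReal : (expNeg 1).toReal = Real.exp (-1) := by
  have := expNeg_coe 1
  rw [ENNReal.coe_one] at this
  rw [this, ENNReal.toReal_ofReal (by positivity)]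
  simp

theorem laplace_toReal_le {N : Ω → PointMeasure E} {f : E → ℝ≥0} {W : Set Ω}
    (hW : MeasurableSet W) (h : ∀ ω ∈ W, 1 ≤ ∫⁻ y, (f y : ℝ≥0∞) ∂(N ω).toMeasure) :
    (laplace P N f).toReal ≤ 1 - (1 - Real.exp (-1)) * P.real W := by
  have hle : laplace P N f ≤ expNeg 1 * P W + P Wᶜ := by
    calc laplace P N f
        ≤ ∫⁻ ω, (W.indicator (fun _ => expNeg 1) ω + Wᶜ.indicator (fun _ => 1) ω) ∂P := by
          refine lintegral_mono fun ω => ?_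
          by_cases hω : ω ∈ W
          · simpa [hω] using expNeg_antitone (h ω hω)
          · simpa [hω] using expNeg_le_one _
      _ = expNeg 1 * P W + P Wᶜ := by
          rw [lintegral_add_left (measurable_const.indicator hW), lintegral_indicator_const hW,
            lintegral_indicator_const hW.compl, one_mul]
  have hne : expNeg 1 * P W ≠ ∞ :=
    ENNReal.mul_ne_top ((expNeg_le_one 1).trans_lt ENNReal.one_lt_top).ne (measure_ne_top P _)
  have := ENNReal.toReal_mono (ENNReal.add_ne_top.2 ⟨hne, measure_ne_top P _⟩) hle
  rw [ENNReal.toReal_add hne (measure_ne_top P _), ENNReal.toReal_mul, expNeg_one_toReal,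
    ← measureReal_def, ← measureReal_def, probReal_compl_eq_one_sub hW] at this
  linarith

theorem le_laplace_toReal {N : Ω → PointMeasure E} {f : E → ℝ≥0} {V : Set Ω}
    (hV : MeasurableSet V) (h : ∀ ω ∉ V, ∫⁻ y, (f y : ℝ≥0∞) ∂(N ω).toMeasure = 0) :
    1 - P.real V ≤ (laplace P N f).toReal := by
  have hle : P Vᶜ ≤ laplace P N f := by
    rw [← lintegral_indicator_one hV.compl]
    refine lintegral_mono fun ω => ?_
    by_cases hω : ω ∈ V
    · simp [hω]
    · simp [hω, h ω hω]
  have := ENNReal.toReal_mono ((laplace_le_one P N f).trans_lt ENNReal.one_lt_top).ne hle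
  rwa [← measureReal_def, probReal_compl_eq_one_sub hV] at this

theorem one_le_ramp {c x : ℝ} (hc : 0 ≤ c) (hx : 0 < x) {y : E} (h : 1 ≤ c * (y - x)) :
    (1 : ℝ≥0∞) ≤ ramp c.toNNReal hx y := by
  have h0 : (0 : ℝ) ≤ y - x := by
    by_contra h0
    nlinarith
  rw [ENNReal.one_le_coe_iff, ramp_apply, ← NNReal.coe_le_coe]
  push_cast
  rwa [Real.coe_toNNReal _ hc, Real.coe_toNNReal _ h0]

/-- Union bound over `T` consecutive windows of length `s`, all with the same exceedance
probability. -/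
theorem StationarySeq.measureReal_exceedCount_mul_le {ξ : ℕ → Ω → ℝ}
    (hstat : StationarySeq P ξ) (t : ℝ) (h s T : ℕ) :
    P.real {ω | 1 ≤ exceedCount ξ t (Finset.Ioc 0 (T * s)) ω} ≤
      T * P.real {ω | 1 ≤ exceedCount ξ t (Finset.Ioc h (h + s)) ω} := by
  have hsh : ∀ h, P.real {ω | 1 ≤ exceedCount ξ t (Finset.Ioc h (h + s)) ω} =
      P.real {ω | 1 ≤ exceedCount ξ t (Finset.Ioc 0 s) ω} := fun h =>
    congrArg ENNReal.toReal (hstat.measure_exceedCount t h s (Set.Ici 1))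
  rw [hsh]
  induction T with
  | zero => simp [exceedCount]
  | succ T ih =>
    have hsub : {ω | 1 ≤ exceedCount ξ t (Finset.Ioc 0 ((T + 1) * s)) ω} ⊆
        {ω | 1 ≤ exceedCount ξ t (Finset.Ioc 0 (T * s)) ω} ∪
          {ω | 1 ≤ exceedCount ξ t (Finset.Ioc (T * s) (T * s + s)) ω} := by
      intro ω hω
      simp only [Set.mem_ofPred_eq, one_le_exceedCount_iff, Set.mem_union, Finset.mem_Ioc] at hω ⊢
      obtain ⟨j, hj, h⟩ := hω
      rw [add_mul, one_mul] at hj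
      by_cases hjT : j ≤ T * s
      · exact Or.inl ⟨j, ⟨hj.1, hjT⟩, h⟩
      · exact Or.inr ⟨j, ⟨by omega, hj.2⟩, h⟩
    have := (measureReal_mono (μ := P) hsub).trans (measureReal_union_le _ _)
    rw [hsh] at this
    push_cast
    linarith

/-- The blocks are long enough for a fixed test function to detect a positive fraction of them. -/
theorem prod_laplace_block_le {ξ : ℕ → Ω → ℝ} (hξ : ∀ j, 1 ≤ j → Measurable (ξ j))
    (hstat : StationarySeq P ξ) (u : ℕ → ℝ) (k : ℕ → ℕ) {n : ℕ} (hk : 2 ≤ k n) (hr : 1 ≤ n / k n) :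
    ∏ i ∈ Finset.Icc 1 (k n),
      (laplace P (blockProcess ξ u k n i)
        (ramp (8 : ℝ).toNNReal (show (0 : ℝ) < 1 / 8 by norm_num))).toReal ≤
      Real.exp (-((1 - Real.exp (-1)) * (k n * P.real (blockExceeds ξ u k n)) / 4)) := by
  set f := ramp (8 : ℝ).toNNReal (show (0 : ℝ) < 1 / 8 by norm_num) with hf
  set q := P.real (blockExceeds ξ u k n) with hq
  set θ := 1 - Real.exp (-1) with hθ
  have hθ0 : 0 ≤ θ := by
    rw [hθ, sub_nonneg, Real.exp_le_one_iff]
    norm_num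
  -- Since `n / k n ≥ 1`, the remainder, being less than `k n`, is shorter than the covered part.
  have hnk : n ≤ 2 * (n / k n * k n) := by
    have h1 := Nat.lt_div_mul_add (a := n) (b := k n) (by omega)
    have h2 : k n ≤ n / k n * k n := Nat.le_mul_of_pos_left _ hr
    omega
  -- The covered part is at least `n / 2`, so the second half of the blocks has indices `j ≥ n / 4`,
  -- where the ramp is at least `8 (1/4 - 1/8) = 1`.
  have hblock : ∀ i ∈ Finset.Ioc (k n - k n / 2) (k n),
      (laplace P (blockProcess ξ u k n i) f).toReal ≤ Real.exp (-(θ * q)) := by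
    intro i hi
    rw [Finset.mem_Ioc] at hi
    have hi1 : 1 ≤ i := by omega
    have hW : MeasurableSet {ω | exceedCount ξ (u n) (block k n i) ω ∈ Set.Ici 1} :=
      measurable_exceedCount_block hξ _ k n i .of_discrete
    have := laplace_toReal_le (P := P) (N := blockProcess ξ u k n i) (f := f) hW ?_
    · rw [measureReal_def, hstat.measure_exceedCount_block _ _ _ hi1, ← blockExceeds_eq,
        ← measureReal_def] at this
      refine this.trans ?_
      have := Real.add_one_le_exp (-(θ * q))
      linarith
    · intro ω hω
      obtain ⟨j, hj, hjξ⟩ := (one_le_exceedCount_iff _ _ _ _).1 hω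
      refine one_le_lintegral_exceedOn hj hjξ (one_le_ramp (by norm_num) _ ?_)
      obtain ⟨h1, -, -, h2, h3⟩ := of_mem_block (Finset.mem_Icc.2 ⟨hi1, hi.2⟩) hj
      rw [coe_toE_div h2 h3]
      have hn : (0 : ℝ) < n := by exact_mod_cast h2.trans h3
      have h4 : n ≤ 4 * j := by
        have h5 : k n ≤ 2 * (i - 1) := by omega
        have h6 : n / k n * k n ≤ n / k n * (2 * (i - 1)) := Nat.mul_le_mul_left _ h5
        have h7 : n / k n * (2 * (i - 1)) = 2 * ((i - 1) * (n / k n)) := by ring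
        omega
      have h4' : (n : ℝ) ≤ 4 * j := by exact_mod_cast h4
      have : (1 : ℝ) / 4 ≤ j / n := by
        rw [le_div_iff₀ hn]
        linarith
      linarith
  have hsub : Finset.Ioc (k n - k n / 2) (k n) ⊆ Finset.Icc 1 (k n) := fun i hi => by
    rw [Finset.mem_Ioc] at hi
    rw [Finset.mem_Icc]
    omega
  calc ∏ i ∈ Finset.Icc 1 (k n), (laplace P (blockProcess ξ u k n i) f).toReal
      ≤ ∏ i ∈ Finset.Ioc (k n - k n / 2) (k n), (laplace P (blockProcess ξ u k n i) f).toReal :=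
        Finset.prod_le_prod_of_subset_of_le_one hsub (fun _ _ => ENNReal.toReal_nonneg)
          fun i _ _ => laplace_toReal_le_one P _ _
    _ ≤ ∏ i ∈ Finset.Ioc (k n - k n / 2) (k n), Real.exp (-(θ * q)) :=
        Finset.prod_le_prod (fun _ _ => ENNReal.toReal_nonneg) hblock
    _ = Real.exp ((k n / 2 : ℕ) * -(θ * q)) := by
        rw [Finset.prod_const, Nat.card_Ioc, Nat.sub_sub_self (Nat.div_le_self _ _),
          ← Real.exp_nat_mul]
    _ ≤ Real.exp (-(θ * (k n * q) / 4)) := by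
        rw [Real.exp_le_exp]
        -- This uses `k n ≥ 2`.
        have h1 : k n ≤ 4 * (k n / 2) := by omega
        have h2 : (k n : ℝ) ≤ 4 * ((k n / 2 : ℕ) : ℝ) := by exact_mod_cast h1
        have h3 : 0 ≤ θ * q := mul_nonneg hθ0 measureReal_nonneg
        nlinarith

/-- By contradiction, with all limits taken along the filter `l` of those large `n` whose blocks
cover at most the fraction `1 - c`. -/
theorem eventually_lt_blockCover {ξ : ℕ → Ω → ℝ} (hξ : ∀ j, 1 ≤ j → Measurable (ξ j))
    (hstat : StationarySeq P ξ) {u : ℕ → ℝ} {k : ℕ → ℕ}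
    (hAI : AsymptoticallyIndependent P (exceedProcess ξ u) k (blockProcess ξ u k))
    {a : ℝ} (ha : 0 < a)
    (hmax : Tendsto (fun n => (k n : ℝ) * P.real (blockExceeds ξ u k n)) atTop (𝓝 a))
    {c : ℝ} (hc : 0 < c) (hc1 : c < 1) :
    ∀ᶠ n : ℕ in atTop, 1 - c < ((k n * (n / k n) : ℕ) : ℝ) / n := by
  by_contra hcon
  rw [not_eventually] at hcon
  set S : Set ℕ := {n : ℕ | ¬ 1 - c < ((k n * (n / k n) : ℕ) : ℝ) / n} with hS
  let l : Filter ℕ := atTop ⊓ 𝓟 S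
  have hl : l.NeBot := frequently_mem_iff_neBot.1 hcon
  have hlt : l ≤ atTop := inf_le_left
  have hlS : ∀ᶠ n in l, n ∈ S := mem_inf_of_right (mem_principal_self S)
  set θ := 1 - Real.exp (-1) with hθ
  have hθ0 : 0 < θ := by
    rw [hθ, sub_pos, Real.exp_lt_one_iff]
    norm_num
  -- no exceedance in the uncovered window
  set s : ℕ → ℕ := fun n => ⌊c * n / 2⌋₊ with hs
  set w : ℕ → ℝ := fun n =>
    P.real {ω | 1 ≤ exceedCount ξ (u n) (Finset.Ioc (n - s n) (n - s n + s n)) ω}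
  have hsn : ∀ n, s n ≤ n := fun n => by
    refine Nat.floor_le_of_le ?_
    have : (0 : ℝ) ≤ n := Nat.cast_nonneg n
    nlinarith
  have hx : 0 < 1 - c := by linarith
  have hwin : Tendsto w l (𝓝 0) := by
    have hLap := (hAI.laplace_sub_prod (ramp (2 / c).toNNReal hx)).mono_left hlt
    refine squeeze_zero' (Eventually.of_forall fun n => measureReal_nonneg) ?_
      (by simpa using hLap.const_mul (1 / θ))
    filter_upwards [hlS, hlt (eventually_ge_atTop 1)] with n hnS hn1
    have hn : (0 : ℝ) < n := by exact_mod_cast hn1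
    -- Every block lies in `(0, 1 - c]`, where the ramp starting at `1 - c` vanishes.
    have hprod : ∏ i ∈ Finset.Icc 1 (k n),
        (laplace P (blockProcess ξ u k n i) (ramp (2 / c).toNNReal hx)).toReal = 1 := by
      refine Finset.prod_eq_one fun i hi => le_antisymm (laplace_toReal_le_one P _ _) ?_
      have := le_laplace_toReal (P := P) (N := blockProcess ξ u k n i)
        (f := ramp (2 / c).toNNReal hx) MeasurableSet.empty ?_
      · simpa using this
      · intro ω _
        refine (lintegral_exceedOn ξ u n _ ω _).trans (Finset.sum_eq_zero fun j hj => ?_)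
        obtain ⟨-, -, h1, h2, h3⟩ := of_mem_block hi hj
        have h4 : (j : ℝ) / n ≤ 1 - c := by
          refine le_trans ?_ (not_lt.1 hnS)
          gcongr
        rw [ramp_apply, coe_toE_div h2 h3, Real.toNNReal_of_nonpos
          (show (j : ℝ) / n - (1 - c) ≤ 0 by linarith)]
        simp
    have hup := laplace_toReal_le (P := P) (N := exceedProcess ξ u n)
      (f := ramp (2 / c).toNNReal hx)
      (W := {ω | 1 ≤ exceedCount ξ (u n) (Finset.Ioc (n - s n) (n - s n + s n)) ω})
      (measurable_exceedCount hξ _ _ _ (measurableSet_Ici (a := 1))) ?_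
    · rw [hprod, abs_sub_comm, abs_of_nonneg (sub_nonneg.2 (laplace_toReal_le_one P _ _)),
        inv_mul_eq_div, le_div_iff₀ hθ0]
      linarith
    · intro ω hω
      obtain ⟨j, hj, hjξ⟩ := (one_le_exceedCount_iff _ _ _ _).1 hω
      rw [Finset.mem_Ioc] at hj
      have := hsn n
      refine one_le_lintegral_exceedOn (Finset.mem_Icc.2 (by omega)) hjξ
        (one_le_ramp (by positivity) _ ?_)
      rw [coe_toE_div (by omega) (by omega)]
      have h1 : (s n : ℝ) ≤ c * n / 2 := Nat.floor_le (by positivity)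
      have h2 : (n : ℝ) ≤ j + s n := by exact_mod_cast (by omega : n ≤ j + s n)
      -- The window consists of the last `s n ≤ c n / 2` indices; there the ramp of slope `2 / c`
      -- has reached `1`.
      have h3 : 1 - c / 2 ≤ (j : ℝ) / n := by
        rw [le_div_iff₀ hn]
        nlinarith
      calc (1 : ℝ) = 2 / c * (c / 2) := by field_simp
        _ ≤ _ := by
          gcongr
          linarith
  -- no exceedance at all
  have hall : Tendsto (fun n => P.real {ω | 1 ≤ exceedCount ξ (u n) (Finset.Ioc 0 (0 + n)) ω}) l
      (𝓝 0) := by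
    refine squeeze_zero' (Eventually.of_forall fun n => measureReal_nonneg) ?_
      (by simpa using hwin.const_mul (⌈4 / c⌉₊ : ℝ))
    -- For `n ≥ 4 / c`, rounding costs at most half: `s n ≥ c n / 2 - 1 ≥ c n / 4`, so `⌈4 / c⌉₊`
    -- windows cover `[1, n]`.
    filter_upwards [hlt (eventually_ge_atTop ⌈4 / c⌉₊)] with n hn
    have h1 : 4 / c ≤ n := Nat.ceil_le.1 hn
    have h2 : 4 ≤ c * n := by
      rw [div_le_iff₀ hc] at h1
      linarith
    have h3 : c * n / 4 ≤ s n := by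
      have := Nat.lt_floor_add_one (c * n / 2)
      change c * n / 4 ≤ (⌊c * n / 2⌋₊ : ℝ)
      linarith
    have h4 : n ≤ ⌈4 / c⌉₊ * s n := by
      have : (n : ℝ) ≤ (⌈4 / c⌉₊ : ℝ) * s n := by
        calc (n : ℝ) = 4 / c * (c * n / 4) := by field_simp
          _ ≤ _ := by
            gcongr
            exact Nat.le_ceil _
      exact_mod_cast this
    refine le_trans (measureReal_mono fun ω hω => ?_)
      (hstat.measureReal_exceedCount_mul_le (u n) (n - s n) (s n) ⌈4 / c⌉₊)
    simp only [Set.mem_ofPred_eq, one_le_exceedCount_iff, Finset.mem_Ioc] at hω ⊢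
    obtain ⟨j, hj, h⟩ := hω
    exact ⟨j, ⟨hj.1, by omega⟩, h⟩
  set f := ramp (8 : ℝ).toNNReal (show (0 : ℝ) < 1 / 8 by norm_num) with hf
  have hN : Tendsto (fun n => (laplace P (exceedProcess ξ u n) f).toReal) l (𝓝 1) := by
    refine tendsto_of_tendsto_of_tendsto_of_le_of_le (by simpa using hall.const_sub 1)
      tendsto_const_nhds (fun n => ?_) fun n => laplace_toReal_le_one P _ _
    refine le_laplace_toReal (P := P)
      (measurable_exceedCount hξ _ _ _ (measurableSet_Ici (a := 1))) fun ω hω => ?_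
    refine (lintegral_exceedOn ξ u n _ ω _).trans (Finset.sum_eq_zero fun j hj => if_neg fun h => ?_)
    refine hω ((one_le_exceedCount_iff _ _ _ _).2 ⟨j, ?_, h⟩)
    simp only [Finset.mem_Icc, Finset.mem_Ioc] at hj ⊢
    omega
  have hprod : Tendsto (fun n => ∏ i ∈ Finset.Icc 1 (k n),
      (laplace P (blockProcess ξ u k n i) f).toReal) l (𝓝 1) := by
    have h0 := (tendsto_zero_iff_abs_tendsto_zero _).2
      ((hAI.laplace_sub_prod f).mono_left hlt)
    simpa using hN.sub h0
  have hexp : Tendsto (fun n => Real.exp (-(θ * (k n * P.real (blockExceeds ξ u k n)) / 4))) l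
      (𝓝 (Real.exp (-(θ * a / 4)))) :=
    (Real.continuous_exp.tendsto _).comp
      (((hmax.mono_left hlt).const_mul θ).div_const 4).neg
  -- The product tends to `1`, yet is eventually at most a quantity tending to `exp (-(θ * a / 4)) <
  -- 1`.
  have h1 : 1 ≤ Real.exp (-(θ * a / 4)) := by
    refine le_of_tendsto_of_tendsto hprod hexp ?_
    filter_upwards [hlt (hAI.tendsto_card.eventually_ge_atTop 2),
      hlt (eventually_one_le_blockLength ha hmax)] with n hk hr
    exact prod_laplace_block_le hξ hstat u k hk hr
  have h2 : Real.exp (-(θ * a / 4)) < 1 := by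
    rw [Real.exp_lt_one_iff]
    have : 0 < θ * a / 4 := by positivity
    linarith
  linarith

/-- Asymptotically, the blocks cover all of the index set. -/
theorem tendsto_blockCover {ξ : ℕ → Ω → ℝ} (hξ : ∀ j, 1 ≤ j → Measurable (ξ j))
    (hstat : StationarySeq P ξ) {u : ℕ → ℝ} {k : ℕ → ℕ}
    (hAI : AsymptoticallyIndependent P (exceedProcess ξ u) k (blockProcess ξ u k))
    {a : ℝ} (ha : 0 < a)
    (hmax : Tendsto (fun n => (k n : ℝ) * P.real (blockExceeds ξ u k n)) atTop (𝓝 a)) :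
    Tendsto (fun n : ℕ => ((k n * (n / k n) : ℕ) : ℝ) / n) atTop (𝓝 1) := by
  rw [tendsto_order]
  refine ⟨fun b hb => ?_, fun b hb => Eventually.of_forall fun n => ?_⟩
  · set c := min (1 - b) (1 / 2) with hc
    have hc0 : 0 < c := lt_min (by linarith) (by norm_num)
    have hc1 : c < 1 := (min_le_right _ _).trans_lt (by norm_num)
    filter_upwards [eventually_lt_blockCover hξ hstat hAI ha hmax hc0 hc1] with n hn
    have : c ≤ 1 - b := min_le_left _ _
    linarith
  · refine lt_of_le_of_lt (div_le_one_of_le₀ ?_ (Nat.cast_nonneg n)) hb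
    exact_mod_cast Nat.mul_div_le n (k n)

end

/-! ### The cluster kernel and the canonical measure -/

section Kernel

theorem clusterKernel_apply (p : ℕ → ℝ) (y : ℝ) {M : Set (PointMeasure E)} (hM : MeasurableSet M) :
    clusterKernel p y M = ∑' m : ℕ, ENNReal.ofReal (p (m + 1)) *
      M.indicator 1 ((m + 1) • PointMeasure.dirac (toE y)) := by
  rw [clusterKernel, Measure.sum_apply _ hM]
  refine tsum_congr fun m => ?_
  rw [Measure.smul_apply, Measure.dirac_apply' _ hM, smul_eq_mul]

theorem measurable_nsmul_dirac_toE (m : ℕ) :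
    Measurable fun y : ℝ => m • PointMeasure.dirac (toE y) :=
  (continuous_dirac_pointMeasure.nsmul m).measurable.comp measurable_toE

theorem measurable_clusterKernel (p : ℕ → ℝ) : Measurable (clusterKernel p) := by
  refine Measure.measurable_of_measurable_coe _ fun M hM => ?_
  simp_rw [clusterKernel_apply p _ hM]
  exact Measurable.tsum fun m =>
    ((measurable_one.indicator hM).comp (measurable_nsmul_dirac_toE (m + 1))).const_mul _

theorem isProbabilityMeasure_clusterKernel {p : ℕ → ℝ} (hp0 : ∀ m, 0 ≤ p (m + 1))
    (hp : HasSum (fun m => p (m + 1)) 1) (y : ℝ) : IsProbabilityMeasure (clusterKernel p y) := by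
  refine ⟨?_⟩
  rw [clusterKernel_apply p y .univ]
  simp only [Set.indicator_univ, Pi.one_apply, mul_one]
  rw [← ENNReal.ofReal_tsum_of_nonneg hp0 hp.summable, hp.tsum_eq, ENNReal.ofReal_one]

theorem isTransitionKernel_clusterKernel {p : ℕ → ℝ} (hp0 : ∀ m, 0 ≤ p (m + 1))
    (hp : HasSum (fun m => p (m + 1)) 1) : IsTransitionKernel (clusterKernel p) :=
  ⟨fun y _ => isProbabilityMeasure_clusterKernel hp0 hp y, fun _ hM =>
    ((Measure.measurable_coe hM).comp (measurable_clusterKernel p)).comp measurable_subtype_coe⟩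

theorem nsmul_dirac_mem_exceedSet_iff (x : ℝ) (m : ℕ) (y : E) :
    (m + 1) • PointMeasure.dirac y ∈ exceedSet x ↔ x < y := by
  rw [mem_exceedSet_iff, PointMeasure.toMeasure_nsmul, PointMeasure.toMeasure_dirac,
    Measure.smul_apply, Measure.dirac_apply' _ (measurableSet_setOf_lt x)]
  by_cases h : x < (y : ℝ) <;> simp [h]

/-- The kernel at `y` charges only multiples of `δ_y`, which all lie in `M_x` if `x < y` and all lie
outside it otherwise. -/
theorem clusterKernel_inter_exceedSet (p : ℕ → ℝ) {M : Set (PointMeasure E)} (hM : MeasurableSet M)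
    {x : ℝ} (hx : 0 < x) {y : ℝ} (hy : y ∈ Set.Ioc (0 : ℝ) 1) :
    clusterKernel p y (M ∩ exceedSet x) = (Set.Ioi x).indicator (fun y => clusterKernel p y M) y := by
  rw [clusterKernel_apply p y (hM.inter (measurableSet_exceedSet hx))]
  have hmem := fun m => nsmul_dirac_mem_exceedSet_iff x m (toE y)
  rw [coe_toE hy] at hmem
  by_cases hxy : x < y
  · rw [Set.indicator_of_mem (by exact hxy), clusterKernel_apply p y hM]
    refine tsum_congr fun m => ?_
    have hm : (m + 1) • PointMeasure.dirac (toE y) ∈ exceedSet x := (hmem m).2 hxy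
    by_cases hmM : (m + 1) • PointMeasure.dirac (toE y) ∈ M
    · rw [Set.indicator_of_mem (Set.mem_inter hmM hm), Set.indicator_of_mem hmM]
    · rw [Set.indicator_of_notMem (fun h => hmM h.1), Set.indicator_of_notMem hmM]
  · rw [Set.indicator_of_notMem (by exact hxy)]
    simp [Set.mem_inter_iff, hmem, hxy]

/-- The distribution of a cluster with a uniformly distributed location. -/
def clusterLaw (p : ℕ → ℝ) : Measure (PointMeasure E) :=
  (volume.restrict (Set.Ioc (0 : ℝ) 1)).bind (clusterKernel p)

theorem isProbabilityMeasure_clusterLaw {p : ℕ → ℝ} (hp0 : ∀ m, 0 ≤ p (m + 1))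
    (hp : HasSum (fun m => p (m + 1)) 1) : IsProbabilityMeasure (clusterLaw p) := by
  have := isProbabilityMeasure_clusterKernel hp0 hp
  refine ⟨?_⟩
  rw [clusterLaw, Measure.bind_apply .univ (measurable_clusterKernel p).aemeasurable]
  simp

/-- The sets `(1/(j+1), 1]` exhaust `E`, so a nonnull measure charges one of them. This makes `{0}`
a Borel set. -/
theorem compl_singleton_zero : ({0}ᶜ : Set (PointMeasure E)) =
    ⋃ j : ℕ, exceedSet (1 / ((j : ℝ) + 1)) := by
  ext μ
  simp only [Set.mem_compl_iff, Set.mem_singleton_iff, Set.mem_iUnion, mem_exceedSet_iff]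
  refine ⟨fun h => ?_, ?_⟩
  · by_contra hne
    push Not at hne
    refine h (PointMeasure.toMeasure_injective (Measure.measure_univ_eq_zero.1 ?_))
    have hU : (Set.univ : Set E) = ⋃ j : ℕ, {y : E | 1 / ((j : ℝ) + 1) < y} :=
      (Set.eq_univ_of_forall fun y : E => Set.mem_iUnion.2 (exists_nat_one_div_lt y.2.1)).symm
    rw [hU]
    exact measure_iUnion_null fun j => le_antisymm (hne j) zero_le
  · rintro ⟨j, hj⟩ rfl
    simp at hj

theorem measurableSet_singleton_zero : MeasurableSet ({0} : Set (PointMeasure E)) := by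
  rw [← MeasurableSet.compl_iff, compl_singleton_zero]
  exact MeasurableSet.iUnion fun j => measurableSet_exceedSet Nat.one_div_pos_of_nat

theorem clusterLaw_singleton_zero (p : ℕ → ℝ) : clusterLaw p {0} = 0 := by
  rw [clusterLaw, Measure.bind_apply measurableSet_singleton_zero
    (measurable_clusterKernel p).aemeasurable]
  simp_rw [clusterKernel_apply p _ measurableSet_singleton_zero]
  have h0 : ∀ (m : ℕ) (y : E), (m + 1) • PointMeasure.dirac y ≠ 0 := fun m y h => by
    have h1 := (nsmul_dirac_mem_exceedSet_iff 0 m y).2 y.2.1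
    rw [h] at h1
    exact h1.1 rfl
  simp [h0]

/-- The canonical measure of the limit process. -/
def clusterMeasure (a : ℝ) (p : ℕ → ℝ) : Measure (PointMeasure E) :=
  ENNReal.ofReal a • clusterLaw p

theorem setLIntegral_clusterIntensity (a : ℝ) (x : ℝ) (g : ℝ → ℝ≥0∞) :
    ∫⁻ y in Set.Ioi x, g y ∂clusterIntensity a =
      ENNReal.ofReal a * ∫⁻ y in Set.Ioc 0 1, (Set.Ioi x).indicator g y := by
  rw [clusterIntensity, Measure.restrict_smul, lintegral_smul_measure,
    lintegral_indicator measurableSet_Ioi, smul_eq_mul]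

theorem clusterMeasure_inter_exceedSet (a : ℝ) (p : ℕ → ℝ) {M : Set (PointMeasure E)}
    (hM : MeasurableSet M) {x : ℝ} (hx : 0 < x) :
    clusterMeasure a p (M ∩ exceedSet x) =
      ∫⁻ y in Set.Ioi x, clusterKernel p y M ∂clusterIntensity a := by
  rw [setLIntegral_clusterIntensity, clusterMeasure, Measure.smul_apply, clusterLaw,
    Measure.bind_apply (hM.inter (measurableSet_exceedSet hx))
      (measurable_clusterKernel p).aemeasurable, smul_eq_mul]
  congr 1
  exact setLIntegral_congr_fun measurableSet_Ioc fun y hy =>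
    clusterKernel_inter_exceedSet p hM hx hy

theorem clusterMeasure_exceedSet (a : ℝ) {p : ℕ → ℝ} (hp0 : ∀ m, 0 ≤ p (m + 1))
    (hp : HasSum (fun m => p (m + 1)) 1) {x : ℝ} (hx : 0 < x) :
    clusterMeasure a p (exceedSet x) = clusterIntensity a (Set.Ioi x) := by
  have := isProbabilityMeasure_clusterKernel hp0 hp
  have h := clusterMeasure_inter_exceedSet a p .univ hx
  rw [Set.univ_inter] at h
  simpa using h

end Kernel

/-! ### Block sums as integrals, and localisation of the blocks -/

section Blocks

variable {Ω : Type*}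

theorem lt_maxPoint_exceedOn_iff {x : ℝ} (hx : 0 < x) (ξ : ℕ → Ω → ℝ) (u : ℕ → ℝ) {n : ℕ}
    {J : Finset ℕ} (hJ : ∀ j ∈ J, 1 ≤ j ∧ j ≤ n) (ω : Ω) :
    x < maxPoint (exceedOn ξ u n J ω) ↔ ∃ j ∈ J, u n < ξ j ω ∧ x < (j : ℝ) / n := by
  rw [lt_maxPoint_iff hx]
  have hatom : ∀ y : E, 0 < (exceedOn ξ u n J ω).toMeasure {y} ↔
      ∃ j ∈ J, u n < ξ j ω ∧ toE ((j : ℝ) / n) = y := fun y => by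
    rw [toMeasure_exceedOn, Measure.finsetSum_apply, Finset.sum_pos_iff]
    refine exists_congr fun j => and_congr_right fun _ => ?_
    split_ifs with h
    · rw [Measure.dirac_apply' _ (measurableSet_singleton y)]
      by_cases hy : toE ((j : ℝ) / n) = y <;> simp [hy, h]
    · simp [h]
  simp_rw [hatom]
  constructor
  · rintro ⟨y, ⟨j, hj, hξ, rfl⟩, hxy⟩
    rw [coe_toE_div (hJ j hj).1 (hJ j hj).2] at hxy
    exact ⟨j, hj, hξ, hxy⟩
  · rintro ⟨j, hj, hξ, hxj⟩
    refine ⟨_, ⟨j, hj, hξ, rfl⟩, ?_⟩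
    rwa [coe_toE_div (hJ j hj).1 (hJ j hj).2]

/-- A configuration of `m` points close to `y` belongs to a given neighbourhood of `m δ_y`. -/
theorem exists_forall_exceedOn_mem {G : Set (PointMeasure E)} (hG : IsOpen G) {m : ℕ} {y : E}
    (hy : m • PointMeasure.dirac y ∈ G) (ξ : ℕ → Ω → ℝ) (u : ℕ → ℝ) :
    ∃ δ > 0, ∀ (n : ℕ) (J : Finset ℕ) (ω : Ω), (∀ j ∈ J, 1 ≤ j ∧ j ≤ n) →
      (∀ j ∈ J, |(j : ℝ) / n - y| < δ) → exceedCount ξ (u n) J ω = m → exceedOn ξ u n J ω ∈ G := by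
  have hc : Continuous fun z : Fin m → E => ∑ l, PointMeasure.dirac (z l) :=
    continuous_finsetSum _ fun l _ => continuous_dirac_pointMeasure.comp (continuous_apply l)
  -- The radius comes from continuity of `(z_1, …, z_m) ↦ ∑ δ_{z_l}` at the diagonal point `(y, …,
  -- y)`, so it depends on none of `n`, `J`, `ω`.
  obtain ⟨δ, hδ, hball⟩ := Metric.isOpen_iff.1 (hG.preimage hc) (fun _ => y) (by simpa using hy)
  refine ⟨δ, hδ, fun n J ω hJ hJy hm => ?_⟩
  set S := J.filter fun j => u n < ξ j ω with hS
  have hcard : S.card = m := by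
    rw [← hm, exceedCount, hS, Finset.card_filter]
  have hex : exceedOn ξ u n J ω = ∑ l : Fin m,
      PointMeasure.dirac (toE ((((S.equivFinOfCardEq hcard).symm l : ℕ) : ℝ) / n)) := by
    rw [exceedOn, ← Finset.sum_filter, ← Finset.sum_coe_sort,
      ← Equiv.sum_comp (S.equivFinOfCardEq hcard).symm]
  rw [hex]
  refine hball ?_
  rw [Metric.mem_ball, dist_pi_lt_iff hδ]
  intro l
  have hl : ((S.equivFinOfCardEq hcard).symm l : ℕ) ∈ J :=
    (Finset.mem_filter.1 ((S.equivFinOfCardEq hcard).symm l).2).1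
  rw [Subtype.dist_eq, Real.dist_eq, coe_toE_div (hJ _ hl).1 (hJ _ hl).2]
  exact hJy _ hl

theorem ceil_mem_Icc {K : ℕ} {y : ℝ} (hK : 1 ≤ K) (hy : y ∈ Set.Ioc (0 : ℝ) 1) :
    ⌈K * y⌉₊ ∈ Finset.Icc 1 K := by
  have hK0 : (0 : ℝ) < K := by exact_mod_cast hK
  rw [Finset.mem_Icc]
  exact ⟨Nat.one_le_iff_ne_zero.2 (Nat.ceil_pos.2 (mul_pos hK0 hy.1)).ne',
    Nat.ceil_le.2 (by nlinarith [hy.2])⟩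

/-- On `((i - 1)/K, i/K]`, an interval of length `1/K`, the index `⌈K * y⌉₊` equals `i`. In this
form the convergence theorems for integrals apply to block sums. -/
theorem sum_Icc_eq_setLIntegral {K : ℕ} (hK : 1 ≤ K) (c : ℕ → ℝ≥0∞) :
    ∑ i ∈ Finset.Icc 1 K, c i = ∫⁻ y in Set.Ioc (0 : ℝ) 1, K * c ⌈K * y⌉₊ := by
  have hK0 : (0 : ℝ) < K := by exact_mod_cast hK
  let I : ℕ → Set ℝ := fun i => Set.Ioc ((((i - 1 : ℕ) : ℝ)) / K) (i / K)
  have hI : ∀ i ∈ Finset.Icc 1 K, ∀ y, y ∈ I i ↔ ⌈K * y⌉₊ = i := fun i hi y => by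
    rw [Nat.ceil_eq_iff (by have := (Finset.mem_Icc.1 hi).1; omega)]
    simp only [I, Set.mem_Ioc, div_lt_iff₀ hK0, le_div_iff₀ hK0, mul_comm y]
  have hU : Set.Ioc (0 : ℝ) 1 = ⋃ i ∈ Finset.Icc 1 K, I i := by
    ext y
    simp only [Set.mem_iUnion, exists_prop]
    constructor
    · intro hy
      exact ⟨_, ceil_mem_Icc hK hy, (hI _ (ceil_mem_Icc hK hy) y).2 rfl⟩
    · rintro ⟨i, hi, h1, h2⟩
      rw [Finset.mem_Icc] at hi
      refine ⟨lt_of_le_of_lt (by positivity) h1, h2.trans ?_⟩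
      rw [div_le_one hK0]
      exact_mod_cast hi.2
  rw [hU, lintegral_biUnion_finset]
  · refine Finset.sum_congr rfl fun i hi => ?_
    rw [setLIntegral_congr_fun (g := fun _ => K * c i) measurableSet_Ioc
      fun y hy => by simp only [(hI i hi y).1 hy], setLIntegral_const, Real.volume_Ioc]
    have : ((i : ℝ) / K - ((i - 1 : ℕ) : ℝ) / K) = (K : ℝ)⁻¹ := by
      rw [Nat.cast_sub (Finset.mem_Icc.1 hi).1]
      field_simp
      simp
    rw [this, ENNReal.ofReal_inv_of_pos hK0, ENNReal.ofReal_natCast, mul_right_comm,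
      ENNReal.mul_inv_cancel (by exact_mod_cast hK0.ne') (ENNReal.natCast_ne_top K), one_mul]
  · intro i hi j hj hij
    refine Set.disjoint_left.2 fun y hyi hyj => hij ?_
    rw [← (hI i hi y).1 hyi, ← (hI j hj y).1 hyj]
  · exact fun i _ => measurableSet_Ioc

/-- With `ρ = k n * (n / k n) / n`, the points `j / n` of this block lie within `ρ / k n` of `ρ y`,
and `ρ → 1`. -/
theorem eventually_block_close {k : ℕ → ℕ} (hk : Tendsto k atTop atTop)
    (hcov : Tendsto (fun n : ℕ => ((k n * (n / k n) : ℕ) : ℝ) / n) atTop (𝓝 1))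
    {y : ℝ} (hy : y ∈ Set.Ioc (0 : ℝ) 1) {δ : ℝ} (hδ : 0 < δ) :
    ∀ᶠ n in atTop, ∀ j ∈ block k n ⌈k n * y⌉₊, |(j : ℝ) / n - y| < δ := by
  have hk' : Tendsto (fun n => ((k n : ℝ))⁻¹) atTop (𝓝 0) :=
    tendsto_inv_atTop_zero.comp (tendsto_natCast_atTop_atTop.comp hk)
  filter_upwards [hk'.eventually (gt_mem_nhds (half_pos hδ)), hk.eventually_ge_atTop 1,
    hcov.eventually (lt_mem_nhds (show 1 - δ / 2 < 1 by linarith)),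
    eventually_ge_atTop 1] with n hn1 hk1 hn2 hn0 j hj
  have hn : (0 : ℝ) < n := by exact_mod_cast hn0
  have hK : (0 : ℝ) < k n := by exact_mod_cast hk1
  obtain ⟨h1, h2, -, -, -⟩ := of_mem_block (ceil_mem_Icc hk1 hy) hj
  set r := n / k n with hr
  set i := ⌈k n * y⌉₊ with hi
  have hi1 : 1 ≤ i := (Finset.mem_Icc.1 (ceil_mem_Icc hk1 hy)).1
  have hiu : (i : ℝ) < k n * y + 1 := Nat.ceil_lt_add_one (by have := hy.1; positivity)
  have hil : k n * y ≤ (i : ℝ) := Nat.le_ceil _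
  set ρ := ((k n * r : ℕ) : ℝ) / n with hρ
  have hρ1 : ρ ≤ 1 := by
    refine div_le_one_of_le₀ ?_ hn.le
    exact_mod_cast Nat.mul_div_le n (k n)
  have hrn : (r : ℝ) / n = ρ * (k n : ℝ)⁻¹ := by
    rw [hρ]
    push_cast
    field_simp
  have hρ0 : 0 ≤ ρ := by positivity
  have h1' : ((i : ℝ) - 1) * r < j := by
    have : (((i - 1) * r : ℕ) : ℝ) < j := by exact_mod_cast h1
    rwa [Nat.cast_mul, Nat.cast_sub hi1, Nat.cast_one] at this
  have h2' : (j : ℝ) ≤ i * r := by exact_mod_cast h2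
  have hup : (j : ℝ) / n ≤ ρ * y + ρ * (k n : ℝ)⁻¹ := by
    calc (j : ℝ) / n ≤ (k n * y + 1) * r / n := by
          gcongr
          exact h2'.trans (by gcongr)
      _ = (k n * y + 1) * (r / n) := by ring
      _ = ρ * y + ρ * (k n : ℝ)⁻¹ := by
          rw [hrn]
          field_simp
  have hlo : ρ * y - ρ * (k n : ℝ)⁻¹ ≤ (j : ℝ) / n := by
    calc ρ * y - ρ * (k n : ℝ)⁻¹ = (k n * y - 1) * (r / n) := by
          rw [hrn]
          field_simp
      _ = (k n * y - 1) * r / n := by ring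
      _ ≤ (j : ℝ) / n := by
          gcongr
          refine le_trans ?_ h1'.le
          gcongr
  have hinv : 0 ≤ (k n : ℝ)⁻¹ := by positivity
  obtain ⟨hy0, hy1⟩ := hy
  have h3 : ρ * (k n : ℝ)⁻¹ ≤ (k n : ℝ)⁻¹ := mul_le_of_le_one_left hinv hρ1
  have h4 : ρ * y ≤ y := mul_le_of_le_one_left hy0.le hρ1
  have h5 : y - ρ * y ≤ 1 - ρ := by nlinarith
  rw [abs_lt]
  constructor <;> linarith

/-- The upper limit of `b` is at most `T` minus the lower limit of `c`, hence at most `T - γ = β`.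
-/
theorem tendsto_of_add_tendsto {ι : Type*} {l : Filter ι} {b c t : ι → ℝ≥0∞} {β γ T : ℝ≥0∞}
    (hT : T ≠ ∞) (ht : Tendsto t l (𝓝 T)) (hbc : ∀ᶠ n in l, b n + c n = t n) (hβγ : β + γ = T)
    (hb : β ≤ liminf b l) (hc : γ ≤ liminf c l) : Tendsto b l (𝓝 β) := by
  rw [tendsto_order]
  refine ⟨fun b' hb' => eventually_lt_of_lt_liminf (hb'.trans_le hb), fun b' hb' => ?_⟩
  have hγ : γ ≠ ∞ := by
    rintro rfl
    exact hT (by rw [← hβγ, add_top])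
  -- The general argument takes some `γ' < γ`, which does not exist when `γ = 0`.
  rcases eq_or_ne γ 0 with rfl | hγ0
  · rw [add_zero] at hβγ
    filter_upwards [hbc, ht.eventually (gt_mem_nhds (hβγ ▸ hb'))] with n h1 h2
    exact (le_self_add.trans h1.le).trans_lt h2
  · have hlt : T < b' + γ := by
      rw [← hβγ]
      exact ENNReal.add_lt_add_right hγ hb'
    have hcont : Tendsto (fun s => b' + s) (𝓝[<] γ) (𝓝 (b' + γ)) :=
      ((continuous_const.add continuous_id).tendsto γ).mono_left nhdsWithin_le_nhds
    have hne : (𝓝[<] γ).NeBot := nhdsLT_neBot_of_exists_lt ⟨0, pos_iff_ne_zero.2 hγ0⟩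
    obtain ⟨γ', h1, h2⟩ :=
      ((hcont.eventually (lt_mem_nhds hlt)).and self_mem_nhdsWithin).exists
    filter_upwards [hbc, ht.eventually (gt_mem_nhds h1),
      eventually_lt_of_lt_liminf (lt_of_lt_of_le h2 hc)] with n h3 h4 h5
    by_contra hcon
    rw [← h3] at h4
    exact absurd h4 (not_lt.2 (add_le_add (not_lt.1 hcon) h5.le))

end Blocks

/-! ### Convergence of the block sums -/

variable {Ω : Type*} {k : ℕ → ℕ}

theorem setOf_lt_maxPoint_subset {x : ℝ} (hx : 0 < x) (ξ : ℕ → Ω → ℝ) (u : ℕ → ℝ) {n i : ℕ}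
    (hi : i ∈ Finset.Icc 1 (k n)) :
    {ω | x < maxPoint (blockProcess ξ u k n i ω)} ⊆
      {ω | exceedCount ξ (u n) (block k n i) ω ∈ Set.Ici 1} := by
  intro ω (hω : x < maxPoint (exceedOn ξ u n (block k n i) ω))
  obtain ⟨j, hj, h, -⟩ := (lt_maxPoint_exceedOn_iff hx ξ u
    (fun j hj => ⟨(of_mem_block hi hj).2.2.2.1, (of_mem_block hi hj).2.2.2.2⟩) ω).1 hω
  exact (one_le_exceedCount_iff _ _ _ _).2 ⟨j, hj, h⟩

variable [MeasurableSpace Ω] {P : Measure Ω} {ξ : ℕ → Ω → ℝ} {u : ℕ → ℝ} {a : ℝ}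

theorem StationarySeq.measure_lt_maxPoint_le (hstat : StationarySeq P ξ) {x : ℝ} (hx : 0 < x)
    (u : ℕ → ℝ) {n i : ℕ} (hi : i ∈ Finset.Icc 1 (k n)) :
    P {ω | x < maxPoint (blockProcess ξ u k n i ω)} ≤ P (blockExceeds ξ u k n) := by
  refine (measure_mono (setOf_lt_maxPoint_subset hx ξ u hi)).trans_eq ?_
  rw [hstat.measure_exceedCount_block _ _ _ (Finset.mem_Icc.1 hi).1, blockExceeds_eq]

theorem measurable_comp_ceil (K : ℕ) (c : ℕ → ℝ≥0∞) :
    Measurable fun y : ℝ => K * c ⌈K * y⌉₊ :=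
  ((measurable_from_nat (f := c)).comp
    (Nat.measurable_ceil.comp (measurable_const_mul (K : ℝ)))).const_mul _

variable [IsProbabilityMeasure P]

theorem natCast_mul_measure_eq_ofReal (m : ℕ) (A : Set Ω) :
    (m : ℝ≥0∞) * P A = ENNReal.ofReal (m * P.real A) := by
  rw [ENNReal.ofReal_mul (Nat.cast_nonneg m), ENNReal.ofReal_natCast, ofReal_measureReal]

/-- In the integral form, a block shrinking to `y > x` exceeds `x` as soon as it has any exceedance,
contributing `a` in the limit; one shrinking to `y < x` eventually contributes nothing. The point `y
= x` is null. -/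
theorem tendsto_sum_lt_maxPoint (hstat : StationarySeq P ξ) (hk : Tendsto k atTop atTop)
    (hcov : Tendsto (fun n : ℕ => ((k n * (n / k n) : ℕ) : ℝ) / n) atTop (𝓝 1))
    (hmax : Tendsto (fun n => (k n : ℝ) * P.real (blockExceeds ξ u k n)) atTop (𝓝 a))
    {x : ℝ} (hx : 0 < x) :
    Tendsto (fun n => ∑ i ∈ Finset.Icc 1 (k n), P {ω | x < maxPoint (blockProcess ξ u k n i ω)})
      atTop (𝓝 (clusterIntensity a (Set.Ioi x))) := by
  set c : ℕ → ℕ → ℝ≥0∞ := fun n i => P {ω | x < maxPoint (blockProcess ξ u k n i ω)} with hc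
  have hmax' : Tendsto (fun n => (k n : ℝ≥0∞) * P (blockExceeds ξ u k n)) atTop
      (𝓝 (ENNReal.ofReal a)) := by
    simp_rw [natCast_mul_measure_eq_ofReal]
    exact ENNReal.tendsto_ofReal hmax
  have hlim : Tendsto (fun n => ∫⁻ y in Set.Ioc (0 : ℝ) 1, k n * c n ⌈k n * y⌉₊) atTop
      (𝓝 (∫⁻ y in Set.Ioc (0 : ℝ) 1, ENNReal.ofReal a * (Set.Ioi x).indicator 1 y)) := by
    -- Each integrand is at most `k n * P (blockExceeds ξ u k n)`, which tends to `a` and is thus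
    -- eventually below `a + 1`.
    refine tendsto_lintegral_filter_of_dominated_convergence (fun _ => ENNReal.ofReal a + 1)
      (Eventually.of_forall fun n => measurable_comp_ceil (k n) (c n)) ?_ (by simp) ?_
    · filter_upwards [hk.eventually_ge_atTop 1, hmax'.eventually
        (gt_mem_nhds (ENNReal.lt_add_right ENNReal.ofReal_ne_top one_ne_zero))] with n hn hlt
      filter_upwards [ae_restrict_mem measurableSet_Ioc] with y hy
      refine le_trans ?_ hlt.le
      gcongr
      exact hstat.measure_lt_maxPoint_le hx u (ceil_mem_Icc hn hy)
    · filter_upwards [ae_restrict_mem measurableSet_Ioc,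
        ae_restrict_of_ae (Measure.ae_ne volume x)] with y hy hyx
      rcases lt_or_gt_of_ne hyx with hlt | hlt
      · rw [Set.indicator_of_notMem (by simpa using hlt.le), mul_zero]
        refine tendsto_const_nhds.congr' ?_
        filter_upwards [hk.eventually_ge_atTop 1,
          eventually_block_close hk hcov hy (sub_pos.2 hlt)] with n hn hclose
        have : {ω | x < maxPoint (blockProcess ξ u k n ⌈k n * y⌉₊ ω)} = ∅ := by
          refine Set.eq_empty_of_forall_notMem fun ω hω => ?_
          obtain ⟨j, hj, -, h⟩ := (lt_maxPoint_exceedOn_iff hx ξ u (fun j hj =>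
            (of_mem_block (ceil_mem_Icc hn hy) hj).2.2.2) ω).1 hω
          have := (abs_lt.1 (hclose j hj)).2
          linarith
        simp only [hc, this, measure_empty, mul_zero]
      · rw [Set.indicator_of_mem (by exact hlt), Pi.one_apply, mul_one]
        refine hmax'.congr' ?_
        filter_upwards [hk.eventually_ge_atTop 1,
          eventually_block_close hk hcov hy (sub_pos.2 hlt)] with n hn hclose
        have hi := ceil_mem_Icc hn hy
        have : {ω | x < maxPoint (blockProcess ξ u k n ⌈k n * y⌉₊ ω)} =
            {ω | exceedCount ξ (u n) (block k n ⌈k n * y⌉₊) ω ∈ Set.Ici 1} := by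
          refine (setOf_lt_maxPoint_subset hx ξ u hi).antisymm fun ω hω => ?_
          obtain ⟨j, hj, h⟩ := (one_le_exceedCount_iff _ _ _ _).1 hω
          refine (lt_maxPoint_exceedOn_iff hx ξ u (fun j hj =>
            (of_mem_block hi hj).2.2.2) ω).2 ⟨j, hj, h, ?_⟩
          have := (abs_lt.1 (hclose j hj)).1
          linarith
        simp only [hc]
        rw [this, hstat.measure_exceedCount_block _ _ _ (Finset.mem_Icc.1 hi).1, blockExceeds_eq]
  have hval : ∫⁻ y in Set.Ioc (0 : ℝ) 1, ENNReal.ofReal a * (Set.Ioi x).indicator 1 y =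
      clusterIntensity a (Set.Ioi x) := by
    rw [lintegral_const_mul _ (measurable_one.indicator measurableSet_Ioi),
      ← setLIntegral_clusterIntensity]
    simp
  rw [hval] at hlim
  refine hlim.congr' ?_
  filter_upwards [hk.eventually_ge_atTop 1] with n hn
  exact (sum_Icc_eq_setLIntegral hn (c n)).symm

/-- Fatou's lemma reduces the bound to a fixed `y > x`. There it suffices to treat finitely many
cluster sizes `m + 1` with `(m + 1) δ_y ∈ G`: once the block is close to `y`, having exactly that
many exceedances forces the block process into `G`. -/
theorem le_liminf_sum_lt_maxPoint_mem (hξ : ∀ j, 1 ≤ j → Measurable (ξ j))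
    (hstat : StationarySeq P ξ) (hk : Tendsto k atTop atTop)
    (hcov : Tendsto (fun n : ℕ => ((k n * (n / k n) : ℕ) : ℝ) / n) atTop (𝓝 1)) (ha : 0 < a)
    (hmax : Tendsto (fun n => (k n : ℝ) * P.real (blockExceeds ξ u k n)) atTop (𝓝 a))
    {p : ℕ → ℝ}
    (hp : ∀ m : ℕ, 1 ≤ m → Tendsto (fun n => clusterProb P ξ u k n m) atTop (𝓝 (p m)))
    {x : ℝ} (hx : 0 < x) {G : Set (PointMeasure E)} (hG : IsOpen G) :
    clusterMeasure a p (G ∩ exceedSet x) ≤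
      liminf (fun n => ∑ i ∈ Finset.Icc 1 (k n),
        P {ω | x < maxPoint (blockProcess ξ u k n i ω) ∧ blockProcess ξ u k n i ω ∈ G}) atTop := by
  set c : ℕ → ℕ → ℝ≥0∞ := fun n i =>
    P {ω | x < maxPoint (blockProcess ξ u k n i ω) ∧ blockProcess ξ u k n i ω ∈ G} with hc
  have hlim : liminf (fun n => ∑ i ∈ Finset.Icc 1 (k n), c n i) atTop =
      liminf (fun n => ∫⁻ y in Set.Ioc (0 : ℝ) 1, k n * c n ⌈k n * y⌉₊) atTop := by
    refine liminf_congr ?_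
    filter_upwards [hk.eventually_ge_atTop 1] with n hn
    exact sum_Icc_eq_setLIntegral hn (c n)
  rw [hlim, clusterMeasure_inter_exceedSet a p hG.measurableSet hx, setLIntegral_clusterIntensity,
    ← lintegral_const_mul' _ _ ENNReal.ofReal_ne_top]
  refine le_trans ?_ (lintegral_liminf_le fun n => measurable_comp_ceil (k n) (c n))
  refine setLIntegral_mono' measurableSet_Ioc fun y hy => ?_
  by_cases hxy : x < y
  swap
  · rw [Set.indicator_of_notMem (by exact hxy), mul_zero]
    exact zero_le
  rw [Set.indicator_of_mem (by exact hxy), clusterKernel_apply p y hG.measurableSet,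
    ← ENNReal.tsum_mul_left]
  refine ENNReal.tsum_le_of_sum_range_le fun L => ?_
  classical
  set S := (Finset.range L).filter fun m => (m + 1) • PointMeasure.dirac (toE y) ∈ G with hS
  have hsum : ∑ m ∈ Finset.range L, ENNReal.ofReal a * (ENNReal.ofReal (p (m + 1)) *
      G.indicator 1 ((m + 1) • PointMeasure.dirac (toE y))) =
      ∑ m ∈ S, ENNReal.ofReal (a * p (m + 1)) := by
    rw [hS, Finset.sum_filter]
    refine Finset.sum_congr rfl fun m _ => ?_
    split_ifs with h
    · rw [Set.indicator_of_mem h, Pi.one_apply, mul_one, ENNReal.ofReal_mul ha.le]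
    · rw [Set.indicator_of_notMem h, mul_zero, mul_zero]
  rw [hsum]
  have htend : Tendsto (fun n => ∑ m ∈ S, (k n : ℝ≥0∞) *
      P {ω | exceedCount ξ (u n) (block k n 1) ω = m + 1}) atTop
      (𝓝 (∑ m ∈ S, ENNReal.ofReal (a * p (m + 1)))) := by
    refine tendsto_finsetSum _ fun m _ => ?_
    simp_rw [natCast_mul_measure_eq_ofReal]
    exact ENNReal.tendsto_ofReal
      (tendsto_card_mul_exceedCount hξ hmax (by omega) (hp (m + 1) (by omega)))
  rw [← htend.liminf_eq]
  refine liminf_le_liminf ?_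
  have hmem : ∀ᶠ n in atTop, ∀ m ∈ S, ∀ ω, exceedCount ξ (u n) (block k n ⌈k n * y⌉₊) ω = m + 1 →
      blockProcess ξ u k n ⌈k n * y⌉₊ ω ∈ G := by
    rw [Filter.eventually_all_finset]
    intro m hm
    obtain ⟨δ, hδ, hδG⟩ := exists_forall_exceedOn_mem hG (Finset.mem_filter.1 hm).2 ξ u
    filter_upwards [hk.eventually_ge_atTop 1, eventually_block_close hk hcov hy hδ] with
      n hn hclose ω hω
    refine hδG n _ ω (fun j hj => (of_mem_block (ceil_mem_Icc hn hy) hj).2.2.2) ?_ hω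
    rwa [coe_toE hy]
  filter_upwards [hk.eventually_ge_atTop 1, hmem,
    eventually_block_close hk hcov hy (sub_pos.2 hxy)] with n hn hmemn hclose
  have hi := ceil_mem_Icc hn hy
  rw [← Finset.mul_sum]
  gcongr
  calc ∑ m ∈ S, P {ω | exceedCount ξ (u n) (block k n 1) ω = m + 1}
      = ∑ m ∈ S, P {ω | exceedCount ξ (u n) (block k n ⌈k n * y⌉₊) ω = m + 1} :=
        Finset.sum_congr rfl fun m _ => (hstat.measure_exceedCount_block (u n) k n
          (Finset.mem_Icc.1 hi).1 {m + 1}).symm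
    _ = P (⋃ m ∈ S, {ω | exceedCount ξ (u n) (block k n ⌈k n * y⌉₊) ω = m + 1}) := by
        rw [measure_biUnion_finset]
        · intro i _ j _ hij
          exact Set.disjoint_left.2 fun ω (hi : _ = i + 1) (hj : _ = j + 1) => hij (by omega)
        · exact fun m _ => measurable_exceedCount_block hξ _ k n _ (measurableSet_singleton _)
    _ ≤ c n ⌈k n * y⌉₊ := by
        refine measure_mono (Set.iUnion₂_subset fun m hm ω (hω : _ = m + 1) =>
          ⟨?_, hmemn m hm ω hω⟩)
        obtain ⟨j, hj, h⟩ := (one_le_exceedCount_iff ξ (u n) (block k n ⌈k n * y⌉₊) ω).1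
          (by omega)
        refine (lt_maxPoint_exceedOn_iff hx ξ u (fun j hj =>
          (of_mem_block hi hj).2.2.2) ω).2 ⟨j, hj, h, ?_⟩
        have := (abs_lt.1 (hclose j hj)).1
        linarith

/-- As in the portmanteau theorem, the bound for open sets passes to sets with null boundary in
`M_x`, among them `M` and `Mᶜ`; their sums add up to those of `tendsto_sum_lt_maxPoint`, so both
bounds are attained. -/
theorem tendsto_sum_lt_maxPoint_mem (hξ : ∀ j, 1 ≤ j → Measurable (ξ j))
    (hstat : StationarySeq P ξ)
    (hmeas : ∀ n, 1 ≤ n → ∀ i ∈ Finset.Icc 1 (k n), Measurable (blockProcess ξ u k n i))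
    (hk : Tendsto k atTop atTop)
    (hcov : Tendsto (fun n : ℕ => ((k n * (n / k n) : ℕ) : ℝ) / n) atTop (𝓝 1)) (ha : 0 < a)
    (hmax : Tendsto (fun n => (k n : ℝ) * P.real (blockExceeds ξ u k n)) atTop (𝓝 a))
    {p : ℕ → ℝ}
    (hp : ∀ m : ℕ, 1 ≤ m → Tendsto (fun n => clusterProb P ξ u k n m) atTop (𝓝 (p m)))
    {x : ℝ} (hx : 0 < x) (hΛ : clusterMeasure a p (exceedSet x) = clusterIntensity a (Set.Ioi x))
    {M : Set (PointMeasure E)} (hM : MeasurableSet M)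
    (hfr : clusterMeasure a p (frontier M ∩ exceedSet x) = 0) :
    Tendsto (fun n => ∑ i ∈ Finset.Icc 1 (k n),
      P {ω | x < maxPoint (blockProcess ξ u k n i ω) ∧ blockProcess ξ u k n i ω ∈ M}) atTop
      (𝓝 (clusterMeasure a p (M ∩ exceedSet x))) := by
  have hopen : ∀ A : Set (PointMeasure E), clusterMeasure a p (frontier A ∩ exceedSet x) = 0 →
      clusterMeasure a p (A ∩ exceedSet x) ≤ liminf (fun n => ∑ i ∈ Finset.Icc 1 (k n),
        P {ω | x < maxPoint (blockProcess ξ u k n i ω) ∧ blockProcess ξ u k n i ω ∈ A}) atTop := by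
    intro A hA
    calc clusterMeasure a p (A ∩ exceedSet x)
        ≤ clusterMeasure a p (interior A ∩ exceedSet x ∪ frontier A ∩ exceedSet x) := by
          refine measure_mono ?_
          rw [← Set.union_inter_distrib_right, ← closure_eq_interior_union_frontier]
          exact Set.inter_subset_inter_left _ subset_closure
      _ ≤ clusterMeasure a p (interior A ∩ exceedSet x) := by
          refine (measure_union_le _ _).trans_eq ?_
          rw [hA, add_zero]
      _ ≤ _ := le_liminf_sum_lt_maxPoint_mem hξ hstat hk hcov ha hmax hp hx isOpen_interior
      _ ≤ _ := by
          refine liminf_le_liminf (Eventually.of_forall fun n => ?_)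
          refine Finset.sum_le_sum fun i _ => measure_mono fun ω hω => ?_
          exact ⟨hω.1, interior_subset hω.2⟩
  refine tendsto_of_add_tendsto (γ := clusterMeasure a p (Mᶜ ∩ exceedSet x)) ?_
    (tendsto_sum_lt_maxPoint hstat hk hcov hmax hx) ?_ ?_ (hopen M hfr)
    (hopen Mᶜ (by rwa [frontier_compl]))
  · have : clusterIntensity a (Set.Ioi x) ≤ ENNReal.ofReal a := by
      rw [clusterIntensity, Measure.smul_apply, smul_eq_mul]
      refine mul_le_of_le_one_right' ((measure_mono (Set.subset_univ _)).trans ?_)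
      simp
    exact (this.trans_lt ENNReal.ofReal_lt_top).ne
  · filter_upwards [eventually_ge_atTop 1] with n hn
    rw [← Finset.sum_add_distrib]
    exact Finset.sum_congr rfl fun i hi =>
      measure_inter_add_sdiff {ω | x < maxPoint (blockProcess ξ u k n i ω)} (hmeas n hn i hi hM)
  · rw [← hΛ, Set.inter_comm, Set.inter_comm Mᶜ, ← Set.sdiff_eq]
    exact measure_inter_add_sdiff _ hM

end ExceedanceProcess

end

open ExceedanceProcess in
theorem proposition3p1 {Ω : Type*} [MeasurableSpace Ω] (P : Measure Ω) [IsProbabilityMeasure P]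
    (ξ : ℕ → Ω → ℝ) (hξ : ∀ j, 1 ≤ j → Measurable (ξ j)) (hstat : StationarySeq P ξ)
    (u : ℕ → ℝ) (hu : Tendsto (fun n : ℕ => (n : ℝ) * P.real {ω | u n < ξ 1 ω}) atTop (𝓝 1))
    (k : ℕ → ℕ)
    (hAI : AsymptoticallyIndependent P (exceedProcess ξ u) k (blockProcess ξ u k))
    (a : ℝ) (ha : 0 < a)
    (hmax : Tendsto (fun n => (k n : ℝ) * P.real (blockExceeds ξ u k n)) atTop (𝓝 a))
    (p : ℕ → ℝ)
    (hp : ∀ m : ℕ, 1 ≤ m → Tendsto (fun n => clusterProb P ξ u k n m) atTop (𝓝 (p m))) :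
    ∃ (Ω' : Type) (_ : MeasurableSpace Ω') (P' : Measure Ω') (_ : IsProbabilityMeasure P')
      (N : Ω' → PointMeasure E) (Λ : Measure (PointMeasure E)),
      Measurable N ∧ InfinitelyDivisible P' N ∧ IsCanonicalMeasure P' N Λ ∧
      ConditionA P k (blockProcess ξ u k) (fixedModuli P' N) Λ ∧
      ConditionB P k (blockProcess ξ u k) (fixedModuli P' N) Λ ∧
      IsTransitionKernel (clusterKernel p) ∧
      DisintegratesAs Λ (clusterIntensity a) (clusterKernel p) := by
  have hp0 : ∀ m, 0 ≤ p (m + 1) := fun m =>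
    ge_of_tendsto' (hp (m + 1) (by omega)) fun n => clusterProb_nonneg P ξ u k n _
  have hps := hasSum_cluster hξ hstat hu ha hmax hp
  have hcov := tendsto_blockCover hξ hstat hAI ha hmax
  have := isProbabilityMeasure_clusterLaw hp0 hps
  -- The limit process is the identity on `M_p(E)` under the compound Poisson law.
  refine ⟨PointMeasure E, inferInstance, compoundPoisson a.toNNReal (clusterLaw p), inferInstance,
    id, clusterMeasure a p, measurable_id, infinitelyDivisible_compoundPoisson _ _,
    isCanonicalMeasure_compoundPoisson _ _ (clusterLaw_singleton_zero p), fun x hx _ => ?_,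
    fun x hx _ _ M hM _ hfr => tendsto_sum_lt_maxPoint_mem hξ hstat hAI.measurable_component
      hAI.tendsto_card hcov ha hmax hp hx (clusterMeasure_exceedSet a hp0 hps hx) hM hfr,
    isTransitionKernel_clusterKernel hp0 hps, fun M hM x hx =>
      ⟨clusterMeasure_exceedSet a hp0 hps hx, clusterMeasure_inter_exceedSet a p hM hx⟩⟩
  rw [clusterMeasure_exceedSet a hp0 hps hx]
  exact tendsto_sum_lt_maxPoint hstat hAI.tendsto_card hcov hmax hx
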